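/- For a bounded convex domain $\Omega\subset\mathbb{R}^2$ let $A_0(\Omega)$ be the set of vector fields $m\in BV(\Omega,\mathbb{R}^2)$ such that $|m|=1$ a.e. in $\Omega$, $\nabla\cdot m=0$ in $\Omega$ in the sense of distributions, and the trace of $m$ on $\partial\Omega$ satisfies $m\cdot n=0$ $\mathcal{H}^1$-a.e. on $\partial\Omega$, where $n$ is the exterior unit normal. For a cost $f:[0,2]\to[0,+\infty]$ and $m\in A_0(\Omega)$ let \[ \mathcal{I}_f(m)=\int_{J(m)} f(|m_+-m_-|)\,\mathrm{d}\mathcal{H}^1 , \] where $J(m)\subset\Omega$ is the (approximate) jump set of $m$ and $m_\pm$ are the one-sided traces of $m$ on it. Let $v^\perp=(-v_2,v_1)$ denote the rotation of $v\in\mathbb{R}^2$ by the angle $\pi/2$. For every $p\in[0,1)$ there is a non-empty bounded convex open set $\Omega\subset\mathbb{R}^2$ such that, for the cost $f(t)=t^p$ (with $t^0=1$), the viscosity solution $m_0=(\nabla\operatorname{dist}(\cdot,\partial\Omega))^\perp$ belongs to $A_0(\Omega)$ but is not a minimizer of $\mathcal{I}_f$ on $A_0(\Omega)$; that is, some $m\in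 A_0(\Omega)$ satisfies $\mathcal{I}_f(m)<\mathcal{I}_f(m_0)$. -/

import Mathlib

open MeasureTheory Filter Topology
open scoped ENNReal RealInnerProductSpace ContDiff

namespace LineEnergy

/-- The Euclidean plane. -/
abbrev Plane : Type := EuclideanSpace ℝ (Fin 2)

/-- Rotation of angle `π / 2` about the origin, `v ↦ v^⊥`. -/
noncomputable def perp (v : Plane) : Plane := !₂[-(v 1), v 0]

/-- The classical divergence `∂₀ ψ₀ + ∂₁ ψ₁` of a vector field. -/
noncomputable def divergence (ψ : Plane → Plane) (x : Plane) : ℝ :=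
  ∑ i : Fin 2, (fderiv ℝ ψ x (EuclideanSpace.single i 1)) i

/-- `u ∈ BV(Ω)` for a scalar function: `u ∈ L¹(Ω)` and the total variation
`sup {∫_Ω u div ψ : ψ ∈ C_c^∞(Ω; ℝ²), |ψ| ≤ 1}` is finite. -/
def IsBVOn (Ω : Set Plane) (u : Plane → ℝ) : Prop :=
  IntegrableOn u Ω ∧
    ∃ C : ℝ, ∀ ψ : Plane → Plane, ContDiff ℝ ∞ ψ → HasCompactSupport ψ → tsupport ψ ⊆ Ω →
      (∀ x, ‖ψ x‖ ≤ 1) → ∫ x in Ω, u x * divergence ψ x ≤ C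

/-- `∇ · m = 0` on `Ω` in the sense of distributions. -/
def IsDivFreeOn (Ω : Set Plane) (m : Plane → Plane) : Prop :=
  ∀ ψ : Plane → ℝ, ContDiff ℝ ∞ ψ → HasCompactSupport ψ → tsupport ψ ⊆ Ω →
    ∫ x in Ω, ⟪m x, gradient ψ x⟫ = 0

/-- The set `A(Ω)` of the fields `m ∈ BV(Ω; ℝ²)` with `|m| = 1` a.e. and `∇ · m = 0` on `Ω`.
Only the values of `m` on `Ω`, up to null sets, matter. -/
def A (Ω : Set Plane) : Set (Plane → Plane) :=
  {m | (∀ i : Fin 2, IsBVOn Ω (fun x => m x i)) ∧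
    (∀ᵐ x ∂(volume.restrict Ω), ‖m x‖ = 1) ∧ IsDivFreeOn Ω m}

/-- `T` is the trace of `m` at the boundary point `x` of `Ω`:
the mean of `|m - T|` over `Ω ∩ B(x, r)` tends to `0` as `r → 0⁺`. -/
def HasBoundaryTrace (Ω : Set Plane) (m : Plane → Plane) (x T : Plane) : Prop :=
  Tendsto (fun r : ℝ => ⨍⁻ y in Ω ∩ Metric.ball x r, ‖m y - T‖ₑ ∂volume) (𝓝[>] 0) (𝓝 0)

/-- `n` is the exterior unit normal of `∂Ω` at `x`: up to an error `o(|y - x|)`, the set `Ω`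
agrees near `x` with the half-plane `{y | ⟪y - x, n⟫ < 0}`. -/
def IsExteriorNormal (Ω : Set Plane) (x n : Plane) : Prop :=
  ‖n‖ = 1 ∧ ∀ ε > 0, ∀ᶠ y in 𝓝 x,
    (⟪y - x, n⟫ < -(ε * ‖y - x‖) → y ∈ Ω) ∧ (ε * ‖y - x‖ < ⟪y - x, n⟫ → y ∉ Ω)

/-- The set `A₀(Ω)` of the fields `m ∈ A(Ω)` with `m · n = 0` a.e. on `∂Ω`
(with respect to length, in the sense of traces). -/
def A₀ (Ω : Set Plane) : Set (Plane → Plane) :=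
  {m | m ∈ A Ω ∧ ∀ᵐ x ∂((μH[1] : Measure Plane).restrict (frontier Ω)),
    ∃ n T : Plane, IsExteriorNormal Ω x n ∧ HasBoundaryTrace Ω m x T ∧ ⟪T, n⟫ = 0}

/-- The open half-ball of centre `x` and radius `r` on the side of `x` to which `ν` points. -/
def halfBall (x ν : Plane) (r : ℝ) : Set Plane :=
  {y | y ∈ Metric.ball x r ∧ 0 < ⟪y - x, ν⟫}

/-- `x` is an approximate jump point of `m`, with unit normal `ν` and distinct one-sided traces
`a = m₊` (on the side of `ν`) and `b = m₋` (on the side of `-ν`). -/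
def HasJump (m : Plane → Plane) (x ν a b : Plane) : Prop :=
  ‖ν‖ = 1 ∧ a ≠ b ∧
    Tendsto (fun r : ℝ => ⨍⁻ y in halfBall x ν r, ‖m y - a‖ₑ ∂volume) (𝓝[>] 0) (𝓝 0) ∧
    Tendsto (fun r : ℝ => ⨍⁻ y in halfBall x (-ν) r, ‖m y - b‖ₑ ∂volume) (𝓝[>] 0) (𝓝 0)

/-- The jump line `J(m)` in `Ω`. -/
def jumpSet (Ω : Set Plane) (m : Plane → Plane) : Set Plane :=
  {x | x ∈ Ω ∧ ∃ ν a b : Plane, HasJump m x ν a b}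

/-- The jump size `|m₊ - m₋|` at `x`. At a jump point the triple `(ν, m₊, m₋)` is unique up to the
exchange with `(-ν, m₋, m₊)`, so that the set below has exactly one element. -/
noncomputable def jumpSize (m : Plane → Plane) (x : Plane) : ℝ :=
  sSup {t : ℝ | ∃ ν a b : Plane, HasJump m x ν a b ∧ t = ‖a - b‖}

/-- The line energy `I_f(m) = ∫_{J(m)} f(|m₊ - m₋|) dℋ¹`. The jump cost `f` is only evaluated
at jump sizes, which lie in `(0, 2]` for `m ∈ A(Ω)`. -/
noncomputable def lineEnergy (f : ℝ → ℝ≥0∞) (Ω : Set Plane) (m : Plane → Plane) : ℝ≥0∞ :=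
  ∫⁻ x in jumpSet Ω m, f (jumpSize m x) ∂(μH[1] : Measure Plane)

/-- The power cost `f(t) = t ^ p`. -/
noncomputable def powerCost (p : ℝ) (t : ℝ) : ℝ≥0∞ := ENNReal.ofReal (t ^ p)

/-- The viscosity solution `(∇ dist(·, ∂Ω))^⊥`. -/
noncomputable def viscositySolution (Ω : Set Plane) (x : Plane) : Plane :=
  perp (gradient (fun y => Metric.infDist y (frontier Ω)) x)

end LineEnergy

open scoped NNReal

namespace LineEnergy

/-! Let `s ^ 2 + c ^ 2 = 1` with `s` small, and let Ω be the interior of the hull of the closed unit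
disc and the point `(0, 1 / c)`. The viscosity solution jumps by `2 * s` along the vertical segment
from the centre to this corner, whose length is at least 1, so it costs at least `(2 * s) ^ p`
(`le_lineEnergy_viscositySolution`). The competitor rotates the gradient of `max (1 - ‖x‖)
(coneGauge s c x - 1)`: a vortex in the disc, whose singularity is a single point, and the opposite
of the viscosity solution near the corner. Tangency at the boundary does not see this change of
sign. The jumps now lie, up to one point, on a curve and a segment in the corner, of total length at
most `7 * s`, and have size at most 2, so the energy is at most `2 ^ p * (7 * s)`
(`lineEnergy_vortexField_le`). Since `p < 1`, `7 * s < s ^ p` for small `s`. Both potentials are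
differences of Lipschitz convex functions and have unit gradient a.e. Distributional Hessians of
convex functions are measures, which gives BV; symmetry of the Hessian gives zero divergence
(`perp_gradient_mem_A`). -/

/-! ### Weak Hessians: rotated gradients of differences of convex functions belong to `A`. -/

lemma lipschitzWith_of_contDiff_of_hasCompactSupport {φ : Plane → ℝ} (hφ : ContDiff ℝ ∞ φ)
    (hc : HasCompactSupport φ) : ∃ C : ℝ≥0, LipschitzWith C φ :=
  hφ.lipschitzWith_of_hasCompactSupport hc (by simp)

lemma contDiff_fderiv_apply {φ : Plane → ℝ} (hφ : ContDiff ℝ ∞ φ) (v : Plane) :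
    ContDiff ℝ ∞ (fun x => fderiv ℝ φ x v) :=
  (hφ.fderiv_right (m := ∞) (by simp)).clm_apply contDiff_const

lemma hasCompactSupport_fderiv_apply {φ : Plane → ℝ} (hc : HasCompactSupport φ) (v : Plane) :
    HasCompactSupport (fun x => fderiv ℝ φ x v) :=
  hc.fderiv_apply (𝕜 := ℝ) v

/-- A distributional Hessian entry: `-⟨∂_v ∂_w u, φ⟩`. -/
noncomputable def weakHessian (u : Plane → ℝ) (v w : Plane) (φ : Plane → ℝ) : ℝ :=
  ∫ x, fderiv ℝ u x v * fderiv ℝ φ x w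

lemma ae_lineDeriv_eq_fderiv {u : Plane → ℝ} {C : ℝ≥0} (hu : LipschitzWith C u) (v : Plane) :
    ∀ᵐ x, lineDeriv ℝ u x v = fderiv ℝ u x v := by
  filter_upwards [hu.ae_differentiableAt] with x hx using hx.lineDeriv_eq_fderiv

lemma integral_fderiv_mul_eq {u : Plane → ℝ} {C : ℝ≥0} (hu : LipschitzWith C u)
    {φ : Plane → ℝ} (hφ : ContDiff ℝ ∞ φ) (hc : HasCompactSupport φ) (v : Plane) :
    ∫ x, fderiv ℝ u x v * φ x = -∫ x, u x * fderiv ℝ φ x v := by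
  obtain ⟨D, hD⟩ := lipschitzWith_of_contDiff_of_hasCompactSupport hφ hc
  have h := hu.integral_lineDeriv_mul_eq (μ := volume) hD hc v
  rw [← integral_neg]
  refine Eq.trans (integral_congr_ae ?_) (h.trans (integral_congr_ae ?_))
  · filter_upwards [ae_lineDeriv_eq_fderiv hu v] with x hx
    rw [hx]
  · refine Eventually.of_forall fun x => ?_
    have : DifferentiableAt ℝ φ x := (hφ.differentiable (by simp)) x
    simp only [this.lineDeriv_eq_fderiv, map_neg]
    ring

/-- Integration by parts moves both derivatives onto the smooth test function, where Schwarz's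
theorem applies. -/
lemma weakHessian_symm {u : Plane → ℝ} {C : ℝ≥0} (hu : LipschitzWith C u)
    {φ : Plane → ℝ} (hφ : ContDiff ℝ ∞ φ) (hc : HasCompactSupport φ) (v w : Plane) :
    weakHessian u v w φ = weakHessian u w v φ := by
  unfold weakHessian
  rw [integral_fderiv_mul_eq hu (contDiff_fderiv_apply hφ w) (hasCompactSupport_fderiv_apply hc w),
    integral_fderiv_mul_eq hu (contDiff_fderiv_apply hφ v) (hasCompactSupport_fderiv_apply hc v)]
  congr 2
  ext x
  congr 1
  have h1 : DifferentiableAt ℝ (fderiv ℝ φ) x :=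
    (hφ.fderiv_right (m := ∞) (by simp)).differentiable (by simp) x
  have hs : IsSymmSndFDerivAt ℝ φ x :=
    hφ.contDiffAt.isSymmSndFDerivAt (by
      rw [minSmoothness_of_isRCLikeNormedField]
      exact WithTop.coe_le_coe.2 (le_top : (2 : ℕ∞) ≤ ⊤))
  have e : ∀ a b : Plane, fderiv ℝ (fun y => fderiv ℝ φ y a) x b = fderiv ℝ (fderiv ℝ φ) x b a := by
    intro a b
    rw [fderiv_clm_apply h1 (differentiableAt_const a)]
    simp
  rw [e, e]
  exact hs.eq v w

lemma integrable_fderiv_mul {u : Plane → ℝ} {C : ℝ≥0} (hu : LipschitzWith C u)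
    {φ : Plane → ℝ} (hφ : Continuous φ) (hc : HasCompactSupport φ) (v : Plane) :
    Integrable (fun x => fderiv ℝ u x v * φ x) := by
  refine (hφ.integrable_of_hasCompactSupport hc).bdd_mul
    (measurable_fderiv_apply_const ℝ u v).aestronglyMeasurable (c := C * ‖v‖)
    (Eventually.of_forall fun x => ?_)
  exact ((fderiv ℝ u x).le_opNorm v).trans
    (mul_le_mul_of_nonneg_right (norm_fderiv_le_of_lipschitz ℝ hu) (norm_nonneg v))

lemma integrable_weakHessian {u : Plane → ℝ} {C : ℝ≥0} (hu : LipschitzWith C u)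
    {φ : Plane → ℝ} (hφ : ContDiff ℝ ∞ φ) (hc : HasCompactSupport φ) (v w : Plane) :
    Integrable (fun x => fderiv ℝ u x v * fderiv ℝ φ x w) :=
  integrable_fderiv_mul hu (contDiff_fderiv_apply hφ w).continuous
    (hasCompactSupport_fderiv_apply hc w) v

lemma _root_.ConvexOn.monotone_add_sub {g : Plane → ℝ} (hg : ConvexOn ℝ Set.univ g) (x v : Plane)
    {t : ℝ} (ht : 0 < t) : Monotone (fun s : ℝ => g (x + s • v + t • v) - g (x + s • v)) := by
  have hconv : ConvexOn ℝ Set.univ (fun s : ℝ => g (x + s • v)) := by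
    have := hg.comp_affineMap (AffineMap.lineMap x (x + v) : ℝ →ᵃ[ℝ] Plane)
    simpa [Function.comp_def, AffineMap.lineMap_apply, add_comm] using this
  intro a b hab
  rcases hab.eq_or_lt with rfl | hab
  · rfl
  have e : ∀ s : ℝ, x + s • v + t • v = x + (s + t) • v := fun s => by rw [add_smul, add_assoc]
  simp only [e]
  have h1 := hconv.secant_mono (Set.mem_univ a) (Set.mem_univ (a + t)) (Set.mem_univ (b + t))
    (by linarith) (by linarith) (by linarith)
  have h2 := hconv.secant_mono (Set.mem_univ (b + t)) (Set.mem_univ a) (Set.mem_univ b)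
    (by linarith) (by linarith) (by linarith)
  have h3 : ((g (x + (a + t) • v) - g (x + a • v)) / t) ≤
      ((g (x + (b + t) • v) - g (x + b • v)) / t) := by
    calc _ = (g (x + (a + t) • v) - g (x + a • v)) / (a + t - a) := by rw [add_sub_cancel_left]
      _ ≤ _ := h1
      _ = (g (x + a • v) - g (x + (b + t) • v)) / (a - (b + t)) := by
        rw [← neg_div_neg_eq]; congr 1 <;> ring
      _ ≤ _ := h2
      _ = _ := by rw [← neg_div_neg_eq]; congr 1 <;> ring
  exact (div_le_div_iff_of_pos_right ht).1 h3

/-- The sign is reversed because `weakHessian` omits the minus of the integration by parts. The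
derivative along `v` is replaced by a difference quotient; by convexity the increments of `g` are
monotone along `v`, so the second derivative has a sign before the limit `t → 0⁺`. -/
lemma weakHessian_self_nonpos {g : Plane → ℝ} {C : ℝ≥0} (hg : LipschitzWith C g)
    (hconv : ConvexOn ℝ Set.univ g) {ζ : Plane → ℝ} (hζ : ContDiff ℝ ∞ ζ)
    (hc : HasCompactSupport ζ) (h0 : ∀ x, 0 ≤ ζ x) (v : Plane) :
    weakHessian g v v ζ ≤ 0 := by
  have hlim := hg.integral_inv_smul_sub_mul_tendsto_integral_lineDeriv_mul (μ := volume)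
    ((contDiff_fderiv_apply hζ v).continuous.integrable_of_hasCompactSupport
      (hasCompactSupport_fderiv_apply hc v)) v
  have heq : ∫ x, lineDeriv ℝ g x v * fderiv ℝ ζ x v = weakHessian g v v ζ := by
    refine integral_congr_ae ?_
    filter_upwards [ae_lineDeriv_eq_fderiv hg v] with x hx
    rw [hx]
  rw [heq] at hlim
  refine le_of_tendsto hlim ?_
  filter_upwards [self_mem_nhdsWithin] with t ht
  have ht : 0 < t := ht
  obtain ⟨D, hD⟩ := lipschitzWith_of_contDiff_of_hasCompactSupport hζ hc
  have hG : LipschitzWith (C + C) (fun x => g (x + t • v) - g x) := by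
    have h1 : LipschitzWith C (fun x => g (x + t • v)) := by
      have := hg.comp (LipschitzWith.id.add (LipschitzWith.const (α := Plane) (t • v)))
      rw [add_zero, mul_one] at this
      exact this
    exact h1.sub hg
  have ibp := hG.integral_lineDeriv_mul_eq (μ := volume) hD hc v
  have hpos : 0 ≤ ∫ x, lineDeriv ℝ (fun x => g (x + t • v) - g x) x v * ζ x := by
    refine integral_nonneg fun x => mul_nonneg ?_ (h0 x)
    -- `lineDeriv` is a `deriv` along the line; where it does not exist, its default value 0 is
    -- still nonnegative.
    exact (hconv.monotone_add_sub x v ht).deriv_nonneg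
  rw [ibp] at hpos
  have e : ∫ x, t⁻¹ • (g (x + t • v) - g x) * fderiv ℝ ζ x v =
      -(t⁻¹ * ∫ x, lineDeriv ℝ ζ x (-v) * (g (x + t • v) - g x)) := by
    rw [← integral_const_mul, ← integral_neg]
    congr 1
    ext x
    have : DifferentiableAt ℝ ζ x := (hζ.differentiable (by simp)) x
    simp only [this.lineDeriv_eq_fderiv, map_neg, smul_eq_mul]
    ring
  rw [e]
  have := inv_pos.2 ht
  nlinarith [mul_nonneg this.le hpos]

lemma weakHessian_sub_test {u : Plane → ℝ} {C : ℝ≥0} (hu : LipschitzWith C u)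
    {φ η : Plane → ℝ} (hφ : ContDiff ℝ ∞ φ) (hc : HasCompactSupport φ) (hη : ContDiff ℝ ∞ η)
    (hηc : HasCompactSupport η) (v w : Plane) :
    weakHessian u v w (fun x => η x - φ x) = weakHessian u v w η - weakHessian u v w φ := by
  unfold weakHessian
  rw [← integral_sub (integrable_weakHessian hu hη hηc v w) (integrable_weakHessian hu hφ hc v w)]
  congr 1
  ext x
  rw [fderiv_fun_sub (hη.differentiable (by simp) x) (hφ.differentiable (by simp) x)]
  simp only [sub_apply]
  ring

lemma weakHessian_neg_test (u : Plane → ℝ) (φ : Plane → ℝ) (v w : Plane) :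
    weakHessian u v w (fun x => -φ x) = -weakHessian u v w φ := by
  unfold weakHessian
  rw [← integral_neg]
  congr 1
  ext x
  rw [fderiv_fun_neg]
  simp

/-- A distribution with a sign is bounded by its value on a cutoff: `η` equals 1 on `Ω`, so `η - φ`
and `η + φ` are nonnegative test functions. -/
lemma weakHessian_self_bounded {g : Plane → ℝ} {C : ℝ≥0} (hg : LipschitzWith C g)
    (hconv : ConvexOn ℝ Set.univ g) {Ω : Set Plane} (hΩ : Bornology.IsBounded Ω) (v : Plane) :
    ∃ K : ℝ, ∀ φ : Plane → ℝ, ContDiff ℝ ∞ φ → HasCompactSupport φ → tsupport φ ⊆ Ω →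
      (∀ x, |φ x| ≤ 1) → |weakHessian g v v φ| ≤ K := by
  obtain ⟨R, hR, hΩR⟩ := hΩ.subset_ball_lt 0 0
  let η : ContDiffBump (0 : Plane) := ⟨R, R + 1, hR, by linarith⟩
  have hη : ContDiff ℝ ∞ η := η.contDiff
  have hηc : HasCompactSupport η := η.hasCompactSupport
  have key : ∀ φ : Plane → ℝ, ContDiff ℝ ∞ φ → HasCompactSupport φ → tsupport φ ⊆ Ω →
      (∀ x, |φ x| ≤ 1) → weakHessian g v v η ≤ weakHessian g v v φ := by
    intro φ hφ hc hs h1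
    have := weakHessian_self_nonpos hg hconv (hη.sub hφ) (hηc.sub hc) (fun x => ?_) v
    · have e := weakHessian_sub_test hg hφ hc hη hηc v v
      have e' : weakHessian g v v (fun x => η x - φ x) ≤ 0 := this
      linarith
    · by_cases hx : x ∈ tsupport φ
      · have : η x = 1 := η.one_of_mem_closedBall (Metric.ball_subset_closedBall (hΩR (hs hx)))
        have := (abs_le.1 (h1 x)).2
        linarith
      · have := image_eq_zero_of_notMem_tsupport hx
        have := η.nonneg (x := x)
        linarith
  refine ⟨-weakHessian g v v η, fun φ hφ hc hs h1 => abs_le.2 ⟨?_, ?_⟩⟩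
  · have := key φ hφ hc hs h1
    linarith
  · have hs' : tsupport (fun x => -φ x) ⊆ Ω := by
      have : tsupport (fun x => -φ x) = tsupport φ := by
        unfold tsupport; congr 1; ext x; simp
      rwa [this]
    have := key (fun x => -φ x) hφ.neg hc.neg hs' (by simpa using h1)
    rw [weakHessian_neg_test] at this
    linarith

lemma weakHessian_polarization {u : Plane → ℝ} {C : ℝ≥0} (hu : LipschitzWith C u)
    {φ : Plane → ℝ} (hφ : ContDiff ℝ ∞ φ) (hc : HasCompactSupport φ) (v w : Plane) :
    2 * weakHessian u v w φ =
      weakHessian u (v + w) (v + w) φ - weakHessian u v v φ - weakHessian u w w φ := by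
  have hs := weakHessian_symm hu hφ hc v w
  have i := fun a b => integrable_weakHessian hu hφ hc a b
  have : weakHessian u (v + w) (v + w) φ = weakHessian u v v φ + weakHessian u v w φ +
      (weakHessian u w v φ + weakHessian u w w φ) := by
    unfold weakHessian
    rw [← integral_add (i v v) (i v w), ← integral_add (i w v) (i w w)]
    refine Eq.trans ?_ (integral_add ((i v v).add (i v w)) ((i w v).add (i w w)))
    congr 1
    ext x
    simp only [map_add]
    ring
  linarith

/-- Mixed entries have no sign; polarization reduces them to pure second derivatives. -/
lemma weakHessian_bounded {g : Plane → ℝ} {C : ℝ≥0} (hg : LipschitzWith C g)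
    (hconv : ConvexOn ℝ Set.univ g) {Ω : Set Plane} (hΩ : Bornology.IsBounded Ω) (v w : Plane) :
    ∃ K : ℝ, ∀ φ : Plane → ℝ, ContDiff ℝ ∞ φ → HasCompactSupport φ → tsupport φ ⊆ Ω →
      (∀ x, |φ x| ≤ 1) → |weakHessian g v w φ| ≤ K := by
  obtain ⟨K₁, h₁⟩ := weakHessian_self_bounded hg hconv hΩ (v + w)
  obtain ⟨K₂, h₂⟩ := weakHessian_self_bounded hg hconv hΩ v
  obtain ⟨K₃, h₃⟩ := weakHessian_self_bounded hg hconv hΩ w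
  refine ⟨(K₁ + K₂ + K₃) / 2, fun φ hφ hc hs h => ?_⟩
  have e := weakHessian_polarization hg hφ hc v w
  have a₁ := abs_le.1 (h₁ φ hφ hc hs h)
  have a₂ := abs_le.1 (h₂ φ hφ hc hs h)
  have a₃ := abs_le.1 (h₃ φ hφ hc hs h)
  refine abs_le.2 ⟨?_, ?_⟩ <;> linarith

lemma gradient_coord (u : Plane → ℝ) (x : Plane) (i : Fin 2) :
    gradient u x i = fderiv ℝ u x (EuclideanSpace.single i 1) := by
  have : gradient u x i = ⟪gradient u x, EuclideanSpace.single i (1 : ℝ)⟫ := by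
    rw [EuclideanSpace.inner_single_right]; simp
  rw [this, gradient, InnerProductSpace.toDual_symm_apply]

lemma norm_gradient (u : Plane → ℝ) (x : Plane) : ‖gradient u x‖ = ‖fderiv ℝ u x‖ := by
  simp [gradient]

lemma norm_gradient_le {u : Plane → ℝ} {C : ℝ≥0} (hu : LipschitzWith C u) (x : Plane) :
    ‖gradient u x‖ ≤ C := by
  rw [norm_gradient]
  exact norm_fderiv_le_of_lipschitz ℝ hu

lemma perp_zero_apply (v : Plane) : perp v 0 = -v 1 := by simp [perp]

lemma perp_one_apply (v : Plane) : perp v 1 = v 0 := by simp [perp]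

lemma norm_perp (v : Plane) : ‖perp v‖ = ‖v‖ := by
  simp [EuclideanSpace.norm_eq, Fin.sum_univ_two, perp_zero_apply, perp_one_apply, add_comm]

lemma continuous_perp : Continuous perp := by
  unfold perp
  fun_prop

lemma isBVOn_fderiv_apply {g : Plane → ℝ} {C : ℝ≥0} (hg : LipschitzWith C g)
    (hconv : ConvexOn ℝ Set.univ g) {Ω : Set Plane} (hΩ : Bornology.IsBounded Ω)
    (v : Plane) : IsBVOn Ω (fun x => fderiv ℝ g x v) := by
  constructor
  · have hfin : volume Ω < ⊤ := hΩ.measure_lt_top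
    have : IsFiniteMeasure (volume.restrict Ω) := ⟨by simpa using hfin⟩
    refine Integrable.of_bound (measurable_fderiv_apply_const ℝ g v).aestronglyMeasurable
      (C * ‖v‖) (Eventually.of_forall fun x => ?_)
    exact ((fderiv ℝ g x).le_opNorm v).trans
      (mul_le_mul_of_nonneg_right (norm_fderiv_le_of_lipschitz ℝ hg) (norm_nonneg v))
  · choose K hK using fun i : Fin 2 =>
      weakHessian_bounded hg hconv hΩ v (EuclideanSpace.single i 1)
    refine ⟨∑ i, K i, fun ψ hψ hc hs h1 => ?_⟩
    have hci : ∀ i, ContDiff ℝ ∞ (fun x => ψ x i) := fun i => (contDiff_euclidean.1 hψ) i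
    have hsi : ∀ i, tsupport (fun x => ψ x i) ⊆ tsupport ψ := fun i =>
      closure_mono fun x hx => by
        simp only [Function.mem_support] at hx ⊢
        intro h
        simp [h] at hx
    have hcs : ∀ i, HasCompactSupport (fun x => ψ x i) := fun i =>
      hc.mono' ((subset_tsupport _).trans (hsi i))
    have hdiv : ∀ x, divergence ψ x = ∑ i, fderiv ℝ (fun y => ψ y i) x (EuclideanSpace.single i 1) := by
      intro x
      unfold divergence
      refine Finset.sum_congr rfl fun i _ => ?_
      have hd : HasFDerivAt ψ (fderiv ℝ ψ x) x := (hψ.differentiable (by simp) x).hasFDerivAt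
      have := ((EuclideanSpace.proj i : Plane →L[ℝ] ℝ).hasFDerivAt.comp x hd).fderiv
      simp only [Function.comp_def, EuclideanSpace.coe_proj] at this
      rw [this]
      rfl
    have hzero : ∀ x, x ∉ Ω → fderiv ℝ g x v * divergence ψ x = 0 := by
      intro x hx
      have : fderiv ℝ ψ x = 0 := by
        have := image_eq_zero_of_notMem_tsupport
          (fun h => hx (hs (tsupport_fderiv_subset ℝ h)) : x ∉ tsupport (fderiv ℝ ψ))
        exact this
      simp [divergence, this]
    rw [setIntegral_eq_integral_of_forall_compl_eq_zero hzero]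
    have : ∫ x, fderiv ℝ g x v * divergence ψ x =
        ∑ i, weakHessian g v (EuclideanSpace.single i 1) (fun x => ψ x i) := by
      unfold weakHessian
      rw [← integral_finsetSum _ fun i _ => integrable_weakHessian hg (hci i) (hcs i) v _]
      congr 1
      ext x
      rw [hdiv, Finset.mul_sum]
    rw [this]
    refine Finset.sum_le_sum fun i _ => (le_abs_self _).trans
      (hK i _ (hci i) (hcs i) ((hsi i).trans hs) fun x => ?_)
    exact (PiLp.norm_apply_le (ψ x) i).trans (h1 x)

lemma IsBVOn.congr {Ω : Set Plane} {u w : Plane → ℝ} (hu : IsBVOn Ω u)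
    (h : u =ᵐ[volume.restrict Ω] w) : IsBVOn Ω w := by
  refine ⟨hu.1.congr h, ?_⟩
  obtain ⟨C, hC⟩ := hu.2
  refine ⟨C, fun ψ h1 h2 h3 h4 => le_trans (le_of_eq ?_) (hC ψ h1 h2 h3 h4)⟩
  refine integral_congr_ae ?_
  filter_upwards [h] with x hx
  rw [hx]

lemma IsBVOn.neg {Ω : Set Plane} {u : Plane → ℝ} (hu : IsBVOn Ω u) :
    IsBVOn Ω (fun x => -u x) := by
  refine ⟨Integrable.neg hu.1, ?_⟩
  obtain ⟨C, hC⟩ := hu.2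
  refine ⟨C, fun ψ h1 h2 h3 h4 => ?_⟩
  have hs : tsupport (-ψ) = tsupport ψ := by
    unfold tsupport; congr 1; ext x; simp
  have := hC (-ψ) h1.neg h2.neg (by rwa [hs]) (by simpa using h4)
  refine le_trans (le_of_eq ?_) this
  congr 1
  ext x
  have : divergence (-ψ) x = -divergence ψ x := by
    simp [divergence, fderiv_neg]
  rw [this]
  ring

lemma continuous_divergence {ψ : Plane → Plane} (hψ : ContDiff ℝ ∞ ψ) :
    Continuous (divergence ψ) := by
  unfold divergence
  have := hψ.continuous_fderiv (by simp)
  fun_prop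

lemma hasCompactSupport_divergence {ψ : Plane → Plane} (hc : HasCompactSupport ψ) :
    HasCompactSupport (divergence ψ) := by
  refine (hc.fderiv (𝕜 := ℝ)).mono fun x hx => ?_
  simp only [Function.mem_support] at hx ⊢
  intro h
  exact hx (by simp [divergence, h])

lemma IsBVOn.add {Ω : Set Plane} {u w : Plane → ℝ} (hu : IsBVOn Ω u) (hw : IsBVOn Ω w) :
    IsBVOn Ω (fun x => u x + w x) := by
  refine ⟨Integrable.add hu.1 hw.1, ?_⟩
  obtain ⟨C, hC⟩ := hu.2
  obtain ⟨D, hD⟩ := hw.2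
  refine ⟨C + D, fun ψ h1 h2 h3 h4 => ?_⟩
  obtain ⟨B, hB⟩ := (hasCompactSupport_divergence h2).exists_bound_of_continuous
    (continuous_divergence h1)
  have int : ∀ f : Plane → ℝ, IntegrableOn f Ω →
      Integrable (fun x => f x * divergence ψ x) (volume.restrict Ω) := fun f hf =>
    Integrable.mul_bdd hf (continuous_divergence h1).aestronglyMeasurable
      (Eventually.of_forall hB)
  have : ∫ x in Ω, (u x + w x) * divergence ψ x =
      (∫ x in Ω, u x * divergence ψ x) + ∫ x in Ω, w x * divergence ψ x := by
    rw [← integral_add (int u hu.1) (int w hw.1)]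
    congr 1
    ext x
    ring
  rw [this]
  exact add_le_add (hC ψ h1 h2 h3 h4) (hD ψ h1 h2 h3 h4)

/-- The rotated gradient of a Lipschitz difference of convex functions solving the eikonal equation
belongs to `A(Ω)`. -/
theorem perp_gradient_mem_A {Ω : Set Plane} (hΩ : Bornology.IsBounded Ω) (hm : MeasurableSet Ω)
    {u g h : Plane → ℝ} {C D : ℝ≥0} (hg : LipschitzWith C g) (hh : LipschitzWith D h)
    (hgc : ConvexOn ℝ Set.univ g) (hhc : ConvexOn ℝ Set.univ h) (hu : ∀ x, u x = g x - h x)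
    (heik : ∀ᵐ x, x ∈ Ω → ‖gradient u x‖ = 1) {m : Plane → Plane}
    (hmu : ∀ x ∈ Ω, m x = perp (gradient u x)) : m ∈ A Ω := by
  have hu' : u = fun x => g x - h x := funext hu
  have huL : LipschitzWith (C + D) u := by
    rw [hu']
    exact hg.sub hh
  have hcoord : ∀ v, (fun x => fderiv ℝ g x v + -fderiv ℝ h x v) =ᵐ[volume.restrict Ω]
      fun x => fderiv ℝ u x v := by
    intro v
    refine ae_restrict_of_ae ?_
    filter_upwards [hg.ae_differentiableAt, hh.ae_differentiableAt] with x h1 h2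
    rw [hu', fderiv_fun_sub h1 h2]
    simp [sub_eq_add_neg]
  have hBV : ∀ v, IsBVOn Ω (fun x => fderiv ℝ u x v) := fun v =>
    ((isBVOn_fderiv_apply hg hgc hΩ v).add (isBVOn_fderiv_apply hh hhc hΩ v).neg).congr (hcoord v)
  refine ⟨fun i => ?_, ?_, ?_⟩
  · fin_cases i
    · refine (hBV (EuclideanSpace.single 1 1)).neg.congr ?_
      refine (ae_restrict_iff' hm).2 (Eventually.of_forall fun x hx => ?_)
      simp [hmu x hx, perp_zero_apply, gradient_coord]
    · refine (hBV (EuclideanSpace.single 0 1)).congr ?_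
      refine (ae_restrict_iff' hm).2 (Eventually.of_forall fun x hx => ?_)
      simp [hmu x hx, perp_one_apply, gradient_coord]
  · refine (ae_restrict_iff' hm).2 ?_
    filter_upwards [heik] with x hx hxΩ
    rw [hmu x hxΩ, norm_perp, hx hxΩ]
  · intro ψ hψ hc hs
    have e1 : ∫ x in Ω, ⟪m x, gradient ψ x⟫ = ∫ x in Ω, ⟪perp (gradient u x), gradient ψ x⟫ :=
      setIntegral_congr_fun hm fun x hx => by rw [hmu x hx]
    have hzero : ∀ x, x ∉ Ω → ⟪perp (gradient u x), gradient ψ x⟫ = 0 := by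
      intro x hx
      have : fderiv ℝ ψ x = 0 := image_eq_zero_of_notMem_tsupport
          (fun h => hx (hs (tsupport_fderiv_subset ℝ h)) : x ∉ tsupport (fderiv ℝ ψ))
      simp [gradient, this]
    rw [e1, setIntegral_eq_integral_of_forall_compl_eq_zero hzero]
    -- The pairing of the rotated gradient with the gradient of `ψ` is the difference of the two
    -- mixed weak Hessian entries.
    have hs := weakHessian_symm huL hψ hc (EuclideanSpace.single 0 1) (EuclideanSpace.single 1 1)
    unfold weakHessian at hs
    rw [← sub_eq_zero, ← integral_sub (integrable_weakHessian huL hψ hc _ _)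
      (integrable_weakHessian huL hψ hc _ _)] at hs
    rw [← hs]
    congr 1
    ext x
    rw [PiLp.inner_apply, Fin.sum_univ_two, perp_zero_apply, perp_one_apply]
    simp only [gradient_coord]
    simp
    ring

/-! ### Averaged limits: jumps, boundary traces and normals. -/

lemma tendsto_setLAverage_of_tendsto {P : Set Plane} (hP : MeasurableSet P) {x : Plane}
    {f : Plane → ℝ≥0∞} (h : Tendsto f (𝓝[P] x) (𝓝 0)) :
    Tendsto (fun r : ℝ => ⨍⁻ y in P ∩ Metric.ball x r, f y ∂volume) (𝓝[>] 0) (𝓝 0) := by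
  rw [ENNReal.tendsto_nhds_zero] at h ⊢
  intro ε hε
  obtain ⟨δ, hδ, hsub⟩ := Metric.mem_nhdsWithin_iff.1 (h ε hε)
  filter_upwards [Ioo_mem_nhdsGT hδ] with r hr
  rw [setLAverage_eq]
  refine ENNReal.div_le_of_le_mul ?_
  calc ∫⁻ y in P ∩ Metric.ball x r, f y ≤ ∫⁻ _ in P ∩ Metric.ball x r, ε :=
        setLIntegral_mono' (hP.inter measurableSet_ball) fun y hy =>
          hsub ⟨Metric.ball_subset_ball hr.2.le hy.2, hy.1⟩
    _ = ε * volume (P ∩ Metric.ball x r) := setLIntegral_const _ _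

lemma not_tendsto_setLAverage_of_le {P : Set Plane} (hP : MeasurableSet P) {x : Plane}
    (hpos : ∀ r > 0, volume (P ∩ Metric.ball x r) ≠ 0) {f : Plane → ℝ≥0∞} {δ : ℝ≥0∞} (hδ : 0 < δ)
    (h : ∀ᶠ y in 𝓝[P] x, δ ≤ f y) :
    ¬Tendsto (fun r : ℝ => ⨍⁻ y in P ∩ Metric.ball x r, f y ∂volume) (𝓝[>] 0) (𝓝 0) := by
  intro hlim
  obtain ⟨ρ, hρ, hsub⟩ := Metric.mem_nhdsWithin_iff.1 h
  have hsmall : ∀ᶠ r in 𝓝[>] (0 : ℝ), r ∈ Set.Ioo 0 ρ := Ioo_mem_nhdsGT hρ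
  obtain ⟨r, hr, hlt⟩ := (hsmall.and (hlim.eventually_lt_const hδ)).exists
  refine absurd hlt (not_lt.2 ?_)
  rw [setLAverage_eq]
  have hfin : volume (P ∩ Metric.ball x r) ≠ ⊤ :=
    ((measure_mono Set.inter_subset_right).trans_lt measure_ball_lt_top).ne
  rw [ENNReal.le_div_iff_mul_le (Or.inl (hpos r hr.1)) (Or.inl hfin), ← setLIntegral_const]
  exact setLIntegral_mono' (hP.inter measurableSet_ball) fun y hy =>
    hsub ⟨Metric.ball_subset_ball hr.2.le hy.2, hy.1⟩

/-- The open half-plane through `x` with inner normal `ν`. -/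
def halfPlane (x ν : Plane) : Set Plane := {y | 0 < ⟪y - x, ν⟫}

lemma halfBall_eq (x ν : Plane) (r : ℝ) : halfBall x ν r = halfPlane x ν ∩ Metric.ball x r := by
  ext y
  exact and_comm

lemma isOpen_halfPlane (x ν : Plane) : IsOpen (halfPlane x ν) :=
  isOpen_lt continuous_const (by fun_prop)

lemma volume_halfPlane_inter_ball_ne_zero (x : Plane) {ν : Plane} (hν : ‖ν‖ = 1) {r : ℝ}
    (hr : 0 < r) : volume (halfPlane x ν ∩ Metric.ball x r) ≠ 0 := by
  refine (((isOpen_halfPlane x ν).inter Metric.isOpen_ball).measure_pos volume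
    ⟨x + (r / 2) • ν, ?_, ?_⟩).ne'
  · simp only [halfPlane, Set.mem_ofPred_eq, add_sub_cancel_left, real_inner_smul_left,
      real_inner_self_eq_norm_sq, hν]
    positivity
  · simp [norm_smul, hν, abs_of_pos hr, hr]

lemma norm_le_one_of_tendsto_halfBall {m : Plane → Plane} (hm : ∀ y, ‖m y‖ ≤ 1) {x ν a : Plane}
    (hν : ‖ν‖ = 1)
    (h : Tendsto (fun r : ℝ => ⨍⁻ y in halfBall x ν r, ‖m y - a‖ₑ ∂volume) (𝓝[>] 0) (𝓝 0)) :
    ‖a‖ ≤ 1 := by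
  by_contra! ha
  simp only [halfBall_eq] at h
  refine not_tendsto_setLAverage_of_le (isOpen_halfPlane x ν).measurableSet
    (fun r hr => volume_halfPlane_inter_ball_ne_zero x hν hr)
    (δ := ENNReal.ofReal (‖a‖ - 1)) (by simpa using ha) (Eventually.of_forall fun y => ?_) h
  rw [← ofReal_norm]
  refine ENNReal.ofReal_le_ofReal ?_
  have := norm_sub_norm_le a (m y)
  rw [norm_sub_rev] at this
  linarith [hm y]

lemma eq_of_tendsto_halfBall_of_continuousAt {m : Plane → Plane} {x ν a : Plane}
    (hm : ContinuousAt m x) (hν : ‖ν‖ = 1)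
    (h : Tendsto (fun r : ℝ => ⨍⁻ y in halfBall x ν r, ‖m y - a‖ₑ ∂volume) (𝓝[>] 0) (𝓝 0)) :
    a = m x := by
  by_contra! ha
  simp only [halfBall_eq] at h
  have hpos : 0 < ‖m x - a‖ := norm_pos_iff.2 (sub_ne_zero.2 ha.symm)
  refine not_tendsto_setLAverage_of_le (isOpen_halfPlane x ν).measurableSet
    (fun r hr => volume_halfPlane_inter_ball_ne_zero x hν hr)
    (δ := ENNReal.ofReal (‖m x - a‖ / 2)) (by simpa using hpos) ?_ h
  have hc : ContinuousAt (fun y => ‖m y - a‖) x := (hm.sub continuousAt_const).norm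
  have := (continuousAt_const.eventually_lt hc (half_lt_self hpos) :
    ∀ᶠ y in 𝓝 x, ‖m x - a‖ / 2 < ‖m y - a‖)
  filter_upwards [nhdsWithin_le_nhds this] with y hy
  rw [← ofReal_norm]
  exact ENNReal.ofReal_le_ofReal hy.le

lemma HasJump.not_continuousAt {m : Plane → Plane} {x ν a b : Plane} (h : HasJump m x ν a b) :
    ¬ContinuousAt m x := fun hm =>
  h.2.1 ((eq_of_tendsto_halfBall_of_continuousAt hm h.1 h.2.2.1).trans
    (eq_of_tendsto_halfBall_of_continuousAt hm (by rw [norm_neg, h.1]) h.2.2.2).symm)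

lemma HasJump.norm_sub_le_two {m : Plane → Plane} (hm : ∀ y, ‖m y‖ ≤ 1) {x ν a b : Plane}
    (h : HasJump m x ν a b) : ‖a - b‖ ≤ 2 := by
  have ha := norm_le_one_of_tendsto_halfBall hm h.1 h.2.2.1
  have hb := norm_le_one_of_tendsto_halfBall hm (by rw [norm_neg, h.1]) h.2.2.2
  linarith [norm_sub_le a b]

lemma jumpSize_nonneg (m : Plane → Plane) (x : Plane) : 0 ≤ jumpSize m x := by
  refine Real.sSup_nonneg ?_
  rintro t ⟨ν, a, b, -, rfl⟩
  exact norm_nonneg _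

lemma jumpSize_le_two {m : Plane → Plane} (hm : ∀ y, ‖m y‖ ≤ 1) (x : Plane) :
    jumpSize m x ≤ 2 := by
  refine Real.sSup_le ?_ (by norm_num)
  rintro t ⟨ν, a, b, h, rfl⟩
  exact h.norm_sub_le_two hm

/-- The bound on `m` matters: it makes the set of jump sizes bounded above, without which `sSup`
would be 0. -/
lemma HasJump.le_jumpSize {m : Plane → Plane} (hm : ∀ y, ‖m y‖ ≤ 1) {x ν a b : Plane}
    (h : HasJump m x ν a b) : ‖a - b‖ ≤ jumpSize m x := by
  refine le_csSup ⟨2, ?_⟩ ⟨ν, a, b, h, rfl⟩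
  rintro t ⟨ν, a, b, h, rfl⟩
  exact h.norm_sub_le_two hm

lemma hasJump_of_tendsto {m : Plane → Plane} {x ν a b : Plane} (hν : ‖ν‖ = 1) (hab : a ≠ b)
    (ha : Tendsto m (𝓝[halfPlane x ν] x) (𝓝 a)) (hb : Tendsto m (𝓝[halfPlane x (-ν)] x) (𝓝 b)) :
    HasJump m x ν a b := by
  have key : ∀ {ν a : Plane}, Tendsto m (𝓝[halfPlane x ν] x) (𝓝 a) →
      Tendsto (fun r : ℝ => ⨍⁻ y in halfBall x ν r, ‖m y - a‖ₑ ∂volume) (𝓝[>] 0) (𝓝 0) := by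
    intro ν a h
    simp only [halfBall_eq]
    refine tendsto_setLAverage_of_tendsto (isOpen_halfPlane x ν).measurableSet ?_
    have := (h.sub_const a).enorm
    simpa using this
  exact ⟨hν, hab, key ha, key hb⟩

lemma hasBoundaryTrace_of_tendsto {Ω : Set Plane} (hΩ : MeasurableSet Ω) {m : Plane → Plane}
    {x T : Plane} (h : Tendsto m (𝓝[Ω] x) (𝓝 T)) : HasBoundaryTrace Ω m x T := by
  refine tendsto_setLAverage_of_tendsto hΩ ?_
  have := (h.sub_const T).enorm
  simpa using this

lemma isExteriorNormal_of_hasGradientAt {g : Plane → ℝ} {x n : Plane} (hg : HasGradientAt g n x)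
    (hn : ‖n‖ = 1) (hx : g x = 1) : IsExteriorNormal {y | g y < 1} x n := by
  refine ⟨hn, fun ε hε => ?_⟩
  filter_upwards [(hasGradientAt_iff_isLittleO.1 hg).def hε] with y hy
  rw [hx, Real.norm_eq_abs, real_inner_comm] at hy
  have := abs_le.1 hy
  simp only [not_lt]
  constructor <;> intro h <;> linarith

lemma inner_perp_self (v : Plane) : ⟪perp v, v⟫ = 0 := by
  rw [PiLp.inner_apply, Fin.sum_univ_two, perp_zero_apply, perp_one_apply]
  simp
  ring

lemma perp_neg (v : Plane) : perp (-v) = -perp v := by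
  ext i
  fin_cases i <;> simp [perp]

/-- Points have zero length, so countably many corners are harmless, and either orientation of the
tangent is tangential. -/
theorem mem_A₀_of_tendsto {g : Plane → ℝ} (hg : Continuous g) {m : Plane → Plane}
    (hm : m ∈ A {y | g y < 1}) {S : Set Plane} (hS : S.Countable)
    (h : ∀ x, g x = 1 → x ∉ S → ∃ n : Plane, HasGradientAt g n x ∧ ‖n‖ = 1 ∧
      (Tendsto m (𝓝[{y | g y < 1}] x) (𝓝 (perp n)) ∨
        Tendsto m (𝓝[{y | g y < 1}] x) (𝓝 (-perp n)))) :
    m ∈ A₀ {y | g y < 1} := by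
  refine ⟨hm, ?_⟩
  have hopen : IsOpen {y | g y < 1} := isOpen_lt hg continuous_const
  rw [ae_restrict_iff' isClosed_frontier.measurableSet]
  have := Measure.nullSingletonClass_hausdorff Plane (d := 1) one_pos
  have hnull : ∀ᵐ x ∂(μH[1] : Measure Plane), x ∉ S := by
    rw [ae_iff]
    simpa using hS.measure_zero (μH[1] : Measure Plane)
  filter_upwards [hnull] with x hxS hx
  obtain ⟨n, hgn, hn, hT⟩ := h x (frontier_lt_subset_eq hg continuous_const hx) hxS
  have hnorm := isExteriorNormal_of_hasGradientAt hgn hn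
    (frontier_lt_subset_eq hg continuous_const hx)
  rcases hT with hT | hT
  · exact ⟨n, _, hnorm, hasBoundaryTrace_of_tendsto hopen.measurableSet hT, inner_perp_self n⟩
  · exact ⟨n, _, hnorm, hasBoundaryTrace_of_tendsto hopen.measurableSet hT, by
      rw [inner_neg_left, inner_perp_self, neg_zero]⟩

/-! ### Gradient calculus and an estimate of length by projection. -/

lemma continuousAt_gradient {u : Plane → ℝ} {x : Plane} (h : ContDiffAt ℝ 1 u x) :
    ContinuousAt (gradient u) x :=
  (InnerProductSpace.toDual ℝ Plane).symm.continuous.continuousAt.comp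
    (h.continuousAt_fderiv one_ne_zero)

lemma gradient_congr {u w : Plane → ℝ} {x : Plane} (h : u =ᶠ[𝓝 x] w) :
    gradient u x = gradient w x := by
  rw [gradient, gradient, h.fderiv_eq]

lemma gradient_const_sub (u : Plane → ℝ) (a : ℝ) (x : Plane) :
    gradient (fun y => a - u y) x = -gradient u x := by
  rw [gradient, gradient, fderiv_const_sub, map_neg]

lemma gradient_sub_const (u : Plane → ℝ) (a : ℝ) (x : Plane) :
    gradient (fun y => u y - a) x = gradient u x := by
  rw [gradient, gradient, fderiv_sub_const]

/-- `f` touches `u` from below at `x`, so `u - f` has a minimum there. -/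
lemma fderiv_eq_of_le {u f : Plane → ℝ} {x : Plane} (h : ∀ y, f y ≤ u y) (hx : f x = u x)
    (hu : DifferentiableAt ℝ u x) (hf : DifferentiableAt ℝ f x) :
    fderiv ℝ u x = fderiv ℝ f x := by
  have hmin : IsLocalMin (fun y => u y - f y) x := Eventually.of_forall fun y => by
    have := h y
    simp only [hx]
    linarith
  have := hmin.fderiv_eq_zero
  rw [fderiv_fun_sub hu hf] at this
  exact sub_eq_zero.1 this

/-- A set on which a coordinate is expanding up to a factor `K` has length at most `K` times
the length of an interval containing that coordinate. -/
lemma hausdorffMeasure_le_of_dist_le {S : Set Plane} {K : ℝ≥0} {i : Fin 2} {a b : ℝ}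
    (hK : ∀ x ∈ S, ∀ y ∈ S, dist x y ≤ K * |x i - y i|) (hab : ∀ x ∈ S, x i ∈ Set.Icc a b) :
    μH[1] S ≤ K * ENNReal.ofReal (b - a) := by
  set π : Plane → ℝ := fun x => x i
  -- On `S` the coordinate is injective, so `S` is the image of its projection under a `K`-Lipschitz
  -- inverse.
  set f : ℝ → Plane := Function.invFunOn π S
  have hinj : Set.InjOn π S := fun x hx y hy hxy => by
    have := hK x hx y hy
    have h0 : x i - y i = 0 := sub_eq_zero.2 hxy
    rw [h0, abs_zero, mul_zero] at this
    exact dist_le_zero.1 this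
  have hf : f '' (π '' S) = S := hinj.invFunOn_image subset_rfl
  have hL : LipschitzOnWith K f (π '' S) := by
    refine LipschitzOnWith.of_dist_le_mul ?_
    rintro _ ⟨x, hx, rfl⟩ _ ⟨y, hy, rfl⟩
    have e : ∀ z ∈ S, f (π z) = z := fun z hz => hinj.leftInvOn_invFunOn hz
    rw [e x hx, e y hy, Real.dist_eq]
    exact hK x hx y hy
  calc μH[1] S = μH[1] (f '' (π '' S)) := by rw [hf]
    _ ≤ (K : ℝ≥0∞) ^ (1 : ℝ) * μH[1] (π '' S) := hL.hausdorffMeasure_image_le zero_le_one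
    _ ≤ K * ENNReal.ofReal (b - a) := by
      rw [ENNReal.rpow_one, hausdorffMeasure_real, ← Real.volume_Icc]
      gcongr
      rintro _ ⟨x, hx, rfl⟩
      exact hab x hx

lemma inner_eq (x y : Plane) : ⟪x, y⟫ = x 0 * y 0 + x 1 * y 1 := by
  rw [PiLp.inner_apply, Fin.sum_univ_two]
  simp
  ring

lemma norm_sq_eq (x : Plane) : ‖x‖ ^ 2 = x 0 ^ 2 + x 1 ^ 2 := by
  rw [← real_inner_self_eq_norm_sq, inner_eq]
  ring

lemma abs_coord_le_norm (x : Plane) (i : Fin 2) : |x i| ≤ ‖x‖ := PiLp.norm_apply_le x i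

/-- The gauge of the convex hull of the closed unit disc and of the point `(0, 1 / c)`, where
`s ^ 2 + c ^ 2 = 1`; it is also the support function of the unit vectors `n` with `n 1 ≤ c`. -/
noncomputable def coneGauge (s c : ℝ) (x : Plane) : ℝ :=
  if c * ‖x‖ < x 1 then s * |x 0| + c * x 1 else ‖x‖

/-! ### The cone gauge, its domain and the viscosity solution. -/

section Gauge

variable {s c : ℝ}

lemma mul_abs_lt_of_mem_cone (hs : 0 < s) (hc : 0 < c) (h : s ^ 2 + c ^ 2 = 1) {x : Plane}
    (hx : c * ‖x‖ < x 1) : c * |x 0| < s * x 1 := by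
  have h1 : 0 < x 1 := lt_of_le_of_lt (by positivity) hx
  have h2 : (c * ‖x‖) ^ 2 < x 1 ^ 2 := pow_lt_pow_left₀ hx (by positivity) two_ne_zero
  rw [mul_pow, norm_sq_eq] at h2
  refine lt_of_pow_lt_pow_left₀ 2 (by positivity) ?_
  rw [mul_pow, sq_abs, mul_pow]
  nlinarith

/-- Strict Cauchy–Schwarz: in the cone, `‖x‖ ^ 2` is the square of the gauge plus `(s * x 1 - c * |x
0|) ^ 2`, and the latter is positive. -/
lemma coneGauge_lt_norm (hs : 0 < s) (hc : 0 < c) (h : s ^ 2 + c ^ 2 = 1) {x : Plane}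
    (hx : c * ‖x‖ < x 1) : coneGauge s c x < ‖x‖ := by
  have h1 := mul_abs_lt_of_mem_cone hs hc h hx
  rw [coneGauge, if_pos hx]
  refine lt_of_pow_lt_pow_left₀ 2 (norm_nonneg x) ?_
  have h2 : 0 < (s * x 1 - c * |x 0|) ^ 2 := by
    have := sub_pos.2 h1
    positivity
  rw [norm_sq_eq]
  have h3 := sq_abs (x 0)
  have e : x 0 ^ 2 + x 1 ^ 2 = (s ^ 2 + c ^ 2) * (|x 0| ^ 2 + x 1 ^ 2) := by rw [h, h3, one_mul]
  rw [e]
  nlinarith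

/-- Together with `exists_inner_eq_coneGauge` this makes the gauge a maximum of linear forms with
unit gradient. Lipschitz bound, convexity, eikonal equation and distance formula all follow from
this. -/
lemma inner_le_coneGauge (hs : 0 < s) (hc : 0 < c) (h : s ^ 2 + c ^ 2 = 1) {n : Plane}
    (hn : ‖n‖ = 1) (hnc : n 1 ≤ c) (x : Plane) : ⟪n, x⟫ ≤ coneGauge s c x := by
  by_cases hx : c * ‖x‖ < x 1
  · rw [coneGauge, if_pos hx, inner_eq]
    have h1 := mul_abs_lt_of_mem_cone hs hc h hx
    have hn2 := norm_sq_eq n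
    rw [hn] at hn2
    have h2 : n 0 * x 0 ≤ |n 0| * |x 0| := by
      rw [← abs_mul]
      exact le_abs_self _
    have h3 : |n 0| * s + n 1 * c ≤ 1 := by
      nlinarith [sq_nonneg (|n 0| - s), sq_nonneg (n 1 - c), sq_abs (n 0)]
    have h4 : c * |x 0| * (c - n 1) ≤ s * x 1 * (c - n 1) :=
      mul_le_mul_of_nonneg_right h1.le (by linarith)
    have h5 : 0 ≤ |x 0| * (1 - (|n 0| * s + n 1 * c)) :=
      mul_nonneg (abs_nonneg _) (by linarith)
    -- The difference of the two sides is the sum of the slacks of `h4` and `h5`.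
    have h6 : s * (|n 0| * |x 0| + n 1 * x 1) ≤ s * (s * |x 0| + c * x 1) := by
      have e : |x 0| * (s ^ 2 + c ^ 2) = |x 0| := by rw [h, mul_one]
      linarith
    have := le_of_mul_le_mul_left h6 hs
    linarith
  · rw [coneGauge, if_neg hx]
    have := real_inner_le_norm n x
    rwa [hn, one_mul] at this

lemma norm_mk_eq_one {a b : ℝ} (h : a ^ 2 + b ^ 2 = 1) : ‖(!₂[a, b] : Plane)‖ = 1 := by
  have := norm_sq_eq !₂[a, b]
  simp only [Matrix.cons_val_zero, Matrix.cons_val_one, h] at this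
  exact (pow_eq_one_iff_of_nonneg (norm_nonneg _) two_ne_zero).1 this

lemma exists_inner_eq_coneGauge (hc : 0 < c) (h : s ^ 2 + c ^ 2 = 1)
    (x : Plane) : ∃ n : Plane, ‖n‖ = 1 ∧ n 1 ≤ c ∧ ⟪n, x⟫ = coneGauge s c x := by
  by_cases hx : c * ‖x‖ < x 1
  · rw [coneGauge, if_pos hx]
    rcases le_total 0 (x 0) with h0 | h0
    · refine ⟨!₂[s, c], norm_mk_eq_one h, by simp, ?_⟩
      rw [inner_eq, abs_of_nonneg h0]
      simp
    · refine ⟨!₂[-s, c], norm_mk_eq_one (by linarith [neg_sq s]), by simp, ?_⟩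
      rw [inner_eq, abs_of_nonpos h0]
      simp
  · rw [coneGauge, if_neg hx]
    rcases eq_or_ne x 0 with rfl | h0
    · exact ⟨!₂[1, 0], norm_mk_eq_one (by norm_num), by simpa using hc.le, by simp⟩
    · have hpos := norm_pos_iff.2 h0
      refine ⟨‖x‖⁻¹ • x, ?_, ?_, ?_⟩
      · rw [norm_smul, norm_inv, norm_norm, inv_mul_cancel₀ hpos.ne']
      · rw [PiLp.smul_apply, smul_eq_mul, inv_mul_le_iff₀ hpos]
        linarith
      · rw [real_inner_smul_left, real_inner_self_eq_norm_sq]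
        field_simp

lemma coneGauge_lipschitz (hs : 0 < s) (hc : 0 < c) (h : s ^ 2 + c ^ 2 = 1) :
    LipschitzWith 1 (coneGauge s c) := by
  refine LipschitzWith.of_le_add fun x y => ?_
  obtain ⟨n, hn, hnc, e⟩ := exists_inner_eq_coneGauge hc h x
  have h1 := inner_le_coneGauge hs hc h hn hnc y
  have h2 := real_inner_le_norm n (x - y)
  rw [hn, one_mul, inner_sub_right] at h2
  rw [dist_eq_norm]
  linarith

lemma coneGauge_convexOn (hs : 0 < s) (hc : 0 < c) (h : s ^ 2 + c ^ 2 = 1) :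
    ConvexOn ℝ Set.univ (coneGauge s c) := by
  refine ⟨convex_univ, fun x _ y _ a b ha hb _ => ?_⟩
  obtain ⟨n, hn, hnc, e⟩ := exists_inner_eq_coneGauge hc h (a • x + b • y)
  rw [← e, inner_add_right, real_inner_smul_right, real_inner_smul_right, smul_eq_mul, smul_eq_mul]
  have h1 := inner_le_coneGauge hs hc h hn hnc x
  have h2 := inner_le_coneGauge hs hc h hn hnc y
  gcongr

/-- At a point of differentiability the gradient is that of the touching linear form, a unit vector;
no case analysis is needed. -/
lemma norm_gradient_coneGauge (hs : 0 < s) (hc : 0 < c) (h : s ^ 2 + c ^ 2 = 1) {x : Plane}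
    (hx : DifferentiableAt ℝ (coneGauge s c) x) : ‖gradient (coneGauge s c) x‖ = 1 := by
  obtain ⟨n, hn, hnc, e⟩ := exists_inner_eq_coneGauge hc h x
  rw [norm_gradient, fderiv_eq_of_le (inner_le_coneGauge hs hc h hn hnc) e hx
    (innerSL ℝ n).differentiableAt]
  have : fderiv ℝ (fun y => ⟪n, y⟫) x = innerSL ℝ n := (innerSL ℝ n).fderiv
  rw [this, innerSL_apply_norm, hn]

lemma coneGauge_eventuallyEq_norm {x : Plane} (hx : x 1 < c * ‖x‖) :
    coneGauge s c =ᶠ[𝓝 x] fun y => ‖y‖ := by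
  have : ∀ᶠ y : Plane in 𝓝 x, y 1 < c * ‖y‖ :=
    (isOpen_lt (by fun_prop) (by fun_prop)).mem_nhds hx
  filter_upwards [this] with y hy
  rw [coneGauge, if_neg hy.le.not_gt]

lemma isOpen_cone : IsOpen {y : Plane | c * ‖y‖ < y 1} :=
  isOpen_lt (by fun_prop) (by fun_prop)

lemma coneGauge_eventuallyEq_of_pos {x : Plane} (hx : c * ‖x‖ < x 1) (h0 : 0 < x 0) :
    coneGauge s c =ᶠ[𝓝 x] fun y => ⟪!₂[s, c], y⟫ := by
  have h0' : ∀ᶠ y : Plane in 𝓝 x, 0 < y 0 :=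
    (isOpen_lt (by fun_prop) (by fun_prop)).mem_nhds h0
  filter_upwards [isOpen_cone.mem_nhds hx, h0'] with y hy hy0
  rw [coneGauge, if_pos hy, abs_of_pos hy0, inner_eq]
  simp

lemma coneGauge_eventuallyEq_of_neg {x : Plane} (hx : c * ‖x‖ < x 1) (h0 : x 0 < 0) :
    coneGauge s c =ᶠ[𝓝 x] fun y => ⟪!₂[-s, c], y⟫ := by
  have h0' : ∀ᶠ y : Plane in 𝓝 x, y 0 < 0 :=
    (isOpen_lt (by fun_prop) (by fun_prop)).mem_nhds h0
  filter_upwards [isOpen_cone.mem_nhds hx, h0'] with y hy hy0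
  rw [coneGauge, if_pos hy, abs_of_neg hy0, inner_eq]
  simp

lemma contDiffAt_coneGauge {x : Plane}
    (hx : x 1 < c * ‖x‖ ∧ x ≠ 0 ∨ c * ‖x‖ < x 1 ∧ x 0 ≠ 0) : ContDiffAt ℝ 1 (coneGauge s c) x := by
  rcases hx with ⟨hx, h0⟩ | ⟨hx, h0⟩
  · exact (contDiffAt_norm ℝ h0).congr_of_eventuallyEq (coneGauge_eventuallyEq_norm hx)
  · rcases h0.lt_or_gt with h0 | h0
    · exact (innerSL ℝ _).contDiff.contDiffAt.congr_of_eventuallyEq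
        (coneGauge_eventuallyEq_of_neg hx h0)
    · exact (innerSL ℝ _).contDiff.contDiffAt.congr_of_eventuallyEq
        (coneGauge_eventuallyEq_of_pos hx h0)

/-- The interior of the convex hull of the closed unit disc and of the point `(0, 1 / c)`. -/
def coneDomain (s c : ℝ) : Set Plane := {x | coneGauge s c x < 1}

lemma isOpen_coneDomain (hs : 0 < s) (hc : 0 < c) (h : s ^ 2 + c ^ 2 = 1) :
    IsOpen (coneDomain s c) :=
  isOpen_lt (coneGauge_lipschitz hs hc h).continuous continuous_const

lemma convex_coneDomain (hs : 0 < s) (hc : 0 < c) (h : s ^ 2 + c ^ 2 = 1) :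
    Convex ℝ (coneDomain s c) := by
  have := (coneGauge_convexOn hs hc h).convex_lt 1
  simpa [coneDomain] using this

lemma isBounded_coneDomain (hs : 0 < s) (hc : 0 < c) (h : s ^ 2 + c ^ 2 = 1) :
    Bornology.IsBounded (coneDomain s c) := by
  refine isBounded_iff_forall_norm_le.2 ⟨(c ^ 2)⁻¹, fun x hx => ?_⟩
  have hx : coneGauge s c x < 1 := hx
  have hc1 : c ^ 2 ≤ 1 := by nlinarith
  rw [← one_div, le_div_iff₀ (by positivity)]
  by_cases h1 : c * ‖x‖ < x 1
  · rw [coneGauge, if_pos h1] at hx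
    have : 0 ≤ s * |x 0| := by positivity
    nlinarith
  · rw [coneGauge, if_neg h1] at hx
    nlinarith [norm_nonneg x]

/-- The gauge is 1-Lipschitz and equals 1 on the frontier, so the distance is at least `d`. Moving
by `d` along the maximizing `n` raises the gauge at unit rate and reaches the frontier, so it is at
most `d`. -/
lemma infDist_frontier_coneDomain (hs : 0 < s) (hc : 0 < c) (h : s ^ 2 + c ^ 2 = 1) {x : Plane}
    (hx : x ∈ coneDomain s c) :
    Metric.infDist x (frontier (coneDomain s c)) = 1 - coneGauge s c x := by
  have hL := coneGauge_lipschitz hs hc h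
  have hx' : coneGauge s c x < 1 := hx
  obtain ⟨n, hn, hnc, e⟩ := exists_inner_eq_coneGauge hc h x
  set d := 1 - coneGauge s c x with hd
  have hd0 : 0 < d := by linarith
  have hle : ∀ t, 0 ≤ t → coneGauge s c (x + t • n) ≤ coneGauge s c x + t := by
    intro t ht
    have := hL.dist_le_mul (x + t • n) x
    rw [dist_eq_norm, dist_eq_norm, add_sub_cancel_left, norm_smul, hn, Real.norm_eq_abs,
      Real.norm_eq_abs, abs_of_nonneg ht, NNReal.coe_one] at this
    linarith [(abs_le.1 this).2]
  have hz : x + d • n ∈ frontier (coneDomain s c) := by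
    rw [(isOpen_coneDomain hs hc h).frontier_eq]
    constructor
    · have hcont : Tendsto (fun t : ℝ => x + t • n) (𝓝[<] d) (𝓝 (x + d • n)) := by
        have : Continuous (fun t : ℝ => x + t • n) := by fun_prop
        exact (this.tendsto d).mono_left nhdsWithin_le_nhds
      refine mem_closure_of_tendsto hcont ?_
      filter_upwards [Ioo_mem_nhdsLT hd0] with t ht
      have := hle t ht.1.le
      change coneGauge s c (x + t • n) < 1
      linarith [ht.2]
    · change ¬coneGauge s c (x + d • n) < 1
      have := inner_le_coneGauge hs hc h hn hnc (x + d • n)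
      rw [inner_add_right, real_inner_smul_right, real_inner_self_eq_norm_sq, hn, e] at this
      linarith
  refine le_antisymm ?_ ?_
  · refine (Metric.infDist_le_dist_of_mem hz).trans (le_of_eq ?_)
    rw [dist_eq_norm, sub_add_cancel_left, norm_neg, norm_smul, hn, Real.norm_eq_abs,
      abs_of_pos hd0, mul_one]
  · refine (Metric.le_infDist ⟨_, hz⟩).2 fun y hy => ?_
    have hy1 : coneGauge s c y = 1 := frontier_lt_subset_eq hL.continuous continuous_const hy
    have := hL.dist_le_mul y x
    rw [NNReal.coe_one, one_mul, Real.dist_eq, dist_comm] at this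
    linarith [(abs_le.1 this).2]

lemma viscositySolution_coneDomain (hs : 0 < s) (hc : 0 < c) (h : s ^ 2 + c ^ 2 = 1) {x : Plane}
    (hx : x ∈ coneDomain s c) :
    viscositySolution (coneDomain s c) x = perp (gradient (fun y => 1 - coneGauge s c y) x) := by
  rw [viscositySolution]
  congr 1
  refine gradient_congr ?_
  filter_upwards [(isOpen_coneDomain hs hc h).mem_nhds hx] with y hy
  exact infDist_frontier_coneDomain hs hc h hy

/-- A point where the boundary of `coneDomain s c` is not known to be smooth. -/
def coneCorners (s c : ℝ) : Set Plane := {!₂[s, c], !₂[-s, c], !₂[0, c⁻¹]}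

/-- The excluded points are the two tangency points of the segments with the circle, and the tip. -/
lemma smooth_point_of_notMem_coneCorners
    (h : s ^ 2 + c ^ 2 = 1) {x : Plane} (hx : coneGauge s c x = 1) (hS : x ∉ coneCorners s c) :
    x 1 < c * ‖x‖ ∧ x ≠ 0 ∨ c * ‖x‖ < x 1 ∧ x 0 ≠ 0 := by
  have hx0 : x ≠ 0 := by
    rintro rfl
    simp [coneGauge] at hx
  rcases lt_trichotomy (x 1) (c * ‖x‖) with h1 | h1 | h1
  · exact Or.inl ⟨h1, hx0⟩
  · exfalso
    rw [coneGauge, if_neg h1.le.not_gt] at hx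
    rw [hx, mul_one] at h1
    have h2 := norm_sq_eq x
    rw [hx, h1] at h2
    have h3 : x 0 ^ 2 = s ^ 2 := by linarith
    apply hS
    rcases sq_eq_sq_iff_eq_or_eq_neg.1 h3 with h4 | h4
    · left
      ext i
      fin_cases i <;> simp [h1, h4]
    · right; left
      ext i
      fin_cases i <;> simp [h1, h4]
  · refine Or.inr ⟨h1, fun h2 => hS ?_⟩
    rw [coneGauge, if_pos h1, h2, abs_zero, mul_zero, zero_add] at hx
    right; right
    ext i
    fin_cases i
    · simp [h2]
    · simpa using eq_inv_of_mul_eq_one_right hx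

lemma countable_coneCorners : (coneCorners s c).Countable :=
  ((Set.finite_singleton _).insert _ |>.insert _).countable

theorem viscositySolution_mem_A₀ (hs : 0 < s) (hc : 0 < c) (h : s ^ 2 + c ^ 2 = 1) :
    viscositySolution (coneDomain s c) ∈ A₀ (coneDomain s c) := by
  have hL := coneGauge_lipschitz hs hc h
  have hA : viscositySolution (coneDomain s c) ∈ A (coneDomain s c) := by
    refine perp_gradient_mem_A (isBounded_coneDomain hs hc h)
      (isOpen_coneDomain hs hc h).measurableSet (LipschitzWith.const (1 : ℝ)) hL
      (convexOn_const 1 convex_univ) (coneGauge_convexOn hs hc h) (fun x => rfl) ?_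
      (fun x hx => viscositySolution_coneDomain hs hc h hx)
    filter_upwards [hL.ae_differentiableAt] with x hx _
    rw [gradient_const_sub, norm_neg, norm_gradient_coneGauge hs hc h hx]
  refine mem_A₀_of_tendsto hL.continuous hA (countable_coneCorners (s := s) (c := c))
    fun x hx hS => ?_
  have hd := contDiffAt_coneGauge (s := s) (smooth_point_of_notMem_coneCorners h hx hS)
  have hd1 := hd.differentiableAt one_ne_zero
  refine ⟨_, hd1.hasGradientAt, norm_gradient_coneGauge hs hc h hd1, Or.inr ?_⟩
  rw [← perp_neg]
  have := (continuous_perp.continuousAt.tendsto.comp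
    (continuousAt_gradient hd).neg.tendsto).mono_left
    (nhdsWithin_le_nhds (s := {y | coneGauge s c y < 1}))
  refine this.congr' ?_
  filter_upwards [self_mem_nhdsWithin] with y hy
  rw [viscositySolution_coneDomain hs hc h hy, gradient_const_sub]
  rfl

/-! ### The competitor and its admissibility. -/

/-- The potential of the competitor: a vortex in the unit disc, and the opposite of the distance
to the boundary near the corner `(0, 1 / c)`. -/
noncomputable def vortexPotential (s c : ℝ) (x : Plane) : ℝ :=
  max (1 - ‖x‖) (coneGauge s c x - 1)

/-- The competitor. -/
noncomputable def vortexField (s c : ℝ) (x : Plane) : Plane := perp (gradient (vortexPotential s c) x)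

lemma vortexPotential_lipschitz (hs : 0 < s) (hc : 0 < c) (h : s ^ 2 + c ^ 2 = 1) :
    LipschitzWith 1 (vortexPotential s c) := by
  have h1 : LipschitzWith 1 (fun x : Plane => 1 - ‖x‖) := by
    simpa using (LipschitzWith.const (1 : ℝ)).sub (lipschitzWith_one_norm (E := Plane))
  have h2 : LipschitzWith 1 (fun x => coneGauge s c x - 1) := by
    simpa using (coneGauge_lipschitz hs hc h).sub (LipschitzWith.const (1 : ℝ))
  have h3 := h1.max h2
  rw [max_self] at h3
  exact h3

lemma norm_vortexField_le (hs : 0 < s) (hc : 0 < c) (h : s ^ 2 + c ^ 2 = 1) (x : Plane) :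
    ‖vortexField s c x‖ ≤ 1 := by
  rw [vortexField, norm_perp]
  exact norm_gradient_le (vortexPotential_lipschitz hs hc h) x

/-- Whichever branch attains the maximum touches the potential from below and has unit gradient. -/
lemma norm_gradient_vortexPotential (hs : 0 < s) (hc : 0 < c) (h : s ^ 2 + c ^ 2 = 1) {x : Plane}
    (hx : x ≠ 0) (hu : DifferentiableAt ℝ (vortexPotential s c) x)
    (hg : DifferentiableAt ℝ (coneGauge s c) x) : ‖gradient (vortexPotential s c) x‖ = 1 := by
  have hn : DifferentiableAt ℝ (fun y : Plane => ‖y‖) x := (contDiffAt_norm ℝ hx).differentiableAt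
    one_ne_zero
  rw [norm_gradient]
  rcases le_total (coneGauge s c x - 1) (1 - ‖x‖) with h1 | h1
  · rw [fderiv_eq_of_le (u := vortexPotential s c) (f := fun y => 1 - ‖y‖) (fun y => le_max_left _ _)
      (max_eq_left h1).symm hu (hn.const_sub 1), fderiv_const_sub, norm_neg]
    exact norm_fderiv_norm hn
  · rw [fderiv_eq_of_le (u := vortexPotential s c) (f := fun y => coneGauge s c y - 1) (fun y => le_max_right _ _)
      (max_eq_right h1).symm hu (hg.sub_const 1), fderiv_sub_const, ← norm_gradient]
    exact norm_gradient_coneGauge hs hc h hg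

theorem vortexField_mem_A₀ (hs : 0 < s) (hc : 0 < c) (h : s ^ 2 + c ^ 2 = 1) :
    vortexField s c ∈ A₀ (coneDomain s c) := by
  have hL := coneGauge_lipschitz hs hc h
  have hnc : ConvexOn ℝ Set.univ (fun x : Plane => ‖x‖) := convexOn_univ_norm
  have hA : vortexField s c ∈ A (coneDomain s c) := by
    -- Adding `‖x‖` to both branches of the maximum makes them convex.
    refine perp_gradient_mem_A (g := fun x => max 1 (coneGauge s c x - 1 + ‖x‖))
      (h := fun x => ‖x‖) (isBounded_coneDomain hs hc h)
      (isOpen_coneDomain hs hc h).measurableSet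
      ((LipschitzWith.const (1 : ℝ)).max
        ((hL.sub (LipschitzWith.const (1 : ℝ))).add lipschitzWith_one_norm))
      lipschitzWith_one_norm
      ((convexOn_const 1 convex_univ).sup
        (((coneGauge_convexOn hs hc h).sub (concaveOn_const 1 convex_univ)).add hnc)) hnc
      (u := vortexPotential s c) (fun x => ?_) ?_ (fun x _ => rfl)
    · rw [vortexPotential, ← max_sub_sub_right, add_sub_cancel_right]
    · have h0 : ∀ᵐ x : Plane, x ≠ 0 := by
        rw [ae_iff]
        simp
      filter_upwards [hL.ae_differentiableAt, h0,
        (vortexPotential_lipschitz hs hc h).ae_differentiableAt] with x hx hx0 hxu _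
      exact norm_gradient_vortexPotential hs hc h hx0 hxu hx
  refine mem_A₀_of_tendsto hL.continuous hA (countable_coneCorners (s := s) (c := c))
    fun x hx hS => ?_
  have hsm := smooth_point_of_notMem_coneCorners h hx hS
  have hd := contDiffAt_coneGauge (s := s) hsm
  have hd1 := hd.differentiableAt one_ne_zero
  refine ⟨_, hd1.hasGradientAt, norm_gradient_coneGauge hs hc h hd1, ?_⟩
  rcases hsm with hsm | hsm
  -- On the circular arc the vortex branch is active.
  · right
    rw [← perp_neg]
    have := (continuous_perp.continuousAt.tendsto.comp
      (continuousAt_gradient hd).neg.tendsto).mono_left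
      (nhdsWithin_le_nhds (s := {y | coneGauge s c y < 1}))
    refine this.congr' ?_
    have hev := (coneGauge_eventuallyEq_norm (s := s) hsm.1).eventuallyEq_nhds
    filter_upwards [self_mem_nhdsWithin, nhdsWithin_le_nhds hev] with y hy hyn
    simp only [Function.comp_apply, Pi.neg_apply, vortexField]
    rw [← gradient_const_sub _ 1]
    congr 1
    refine gradient_congr ?_
    filter_upwards [hyn, (isOpen_coneDomain hs hc h).mem_nhds hy] with z hz hz1
    have hz1 : coneGauge s c z < 1 := hz1
    rw [vortexPotential, ← hz, max_eq_left]
    linarith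
  -- On the two segments `‖x‖ > 1`, so the second branch is active and the orientation is reversed.
  · left
    have := (continuous_perp.continuousAt.tendsto.comp
      (continuousAt_gradient hd).tendsto).mono_left
      (nhdsWithin_le_nhds (s := {y | coneGauge s c y < 1}))
    refine this.congr' ?_
    have hlt := coneGauge_lt_norm hs hc h hsm.1
    have hev : ∀ᶠ y in 𝓝 x, 1 - ‖y‖ < coneGauge s c y - 1 := by
      refine (isOpen_lt (by fun_prop)
        (hL.continuous.sub continuous_const)).mem_nhds ?_
      change 1 - ‖x‖ < coneGauge s c x - 1
      linarith
    filter_upwards [nhdsWithin_le_nhds hev.eventually_nhds] with y hy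
    simp only [Function.comp_apply, vortexField]
    rw [← gradient_sub_const _ 1]
    congr 1
    refine gradient_congr ?_
    filter_upwards [hy] with z hz
    rw [vortexPotential, max_eq_right hz.le]

end Gauge

/-! ### The two energy estimates. -/

section Energy

variable {s c : ℝ}

/-- The ridge of `coneDomain s c`. -/
def coneRidge (c : ℝ) : Set Plane := {x | x 0 = 0 ∧ 0 < x 1 ∧ c * x 1 < 1}

lemma measurableSet_coneRidge : MeasurableSet (coneRidge c) := by
  have h1 : IsClosed {x : Plane | x 0 = 0} := isClosed_eq (by fun_prop) (by fun_prop)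
  have h2 : IsOpen {x : Plane | 0 < x 1} := isOpen_lt (by fun_prop) (by fun_prop)
  have h3 : IsOpen {x : Plane | c * x 1 < 1} := isOpen_lt (by fun_prop) (by fun_prop)
  exact h1.measurableSet.inter (h2.inter h3).measurableSet

lemma norm_eq_of_coord_zero {x : Plane} (h0 : x 0 = 0) : ‖x‖ = |x 1| := by
  have := norm_sq_eq x
  rw [h0, zero_pow two_ne_zero, zero_add, ← sq_abs (x 1)] at this
  exact (sq_eq_sq₀ (norm_nonneg _) (abs_nonneg _)).1 this

lemma gradient_inner_left (n x : Plane) : gradient (fun y => ⟪n, y⟫) x = n := by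
  have : fderiv ℝ (fun y => ⟪n, y⟫) x = innerSL ℝ n := (innerSL ℝ n).fderiv
  rw [gradient, this]
  exact (InnerProductSpace.toDual ℝ Plane).symm_apply_apply n

lemma hasJump_viscositySolution (hs : 0 < s) (hc : 0 < c) (h : s ^ 2 + c ^ 2 = 1) {x : Plane}
    (hx : x ∈ coneRidge c) : x ∈ coneDomain s c ∧
      HasJump (viscositySolution (coneDomain s c)) x !₂[1, 0] (perp (-!₂[s, c])) (perp (-!₂[-s, c])) := by
  obtain ⟨h0, h1, h2⟩ := hx
  have hc1 : c < 1 := by nlinarith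
  have hcone : c * ‖x‖ < x 1 := by
    rw [norm_eq_of_coord_zero h0, abs_of_pos h1]
    nlinarith
  have hΩ : x ∈ coneDomain s c := by
    change coneGauge s c x < 1
    rw [coneGauge, if_pos hcone, h0]
    simpa using h2
  have hev : ∀ᶠ y in 𝓝 x, y ∈ coneDomain s c ∧ c * ‖y‖ < y 1 :=
    ((isOpen_coneDomain hs hc h).eventually_mem hΩ).and (isOpen_cone.eventually_mem hcone)
  refine ⟨hΩ, hasJump_of_tendsto (norm_mk_eq_one (by norm_num)) ?_ ?_ ?_⟩
  · intro he
    have := congrArg (fun v : Plane => v 1) he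
    simp [perp] at this
    linarith
  · refine tendsto_const_nhds.congr' ?_
    filter_upwards [self_mem_nhdsWithin, nhdsWithin_le_nhds hev] with y hy hyev
    have hy0 : 0 < y 0 := by
      have hy : 0 < ⟪y - x, !₂[1, 0]⟫ := hy
      rw [inner_eq] at hy
      simpa [h0] using hy
    rw [viscositySolution_coneDomain hs hc h hyev.1, gradient_const_sub,
      gradient_congr (coneGauge_eventuallyEq_of_pos hyev.2 hy0), gradient_inner_left]
  · refine tendsto_const_nhds.congr' ?_
    filter_upwards [self_mem_nhdsWithin, nhdsWithin_le_nhds hev] with y hy hyev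
    have hy0 : y 0 < 0 := by
      have hy : 0 < ⟪y - x, -!₂[1, 0]⟫ := hy
      rw [inner_eq] at hy
      simpa [h0] using hy
    rw [viscositySolution_coneDomain hs hc h hyev.1, gradient_const_sub,
      gradient_congr (coneGauge_eventuallyEq_of_neg hyev.2 hy0), gradient_inner_left]

/-- Projection onto the second coordinate does not increase length, and the image contains `(0, 1)`.
-/
lemma one_le_hausdorffMeasure_coneRidge (hc : 0 < c) (hc1 : c ≤ 1) : 1 ≤ μH[1] (coneRidge c) := by
  have hL : LipschitzWith 1 (fun x : Plane => x 1) :=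
    LipschitzWith.of_le_add fun x y => by
      have := abs_coord_le_norm (x - y) 1
      rw [PiLp.sub_apply] at this
      rw [dist_eq_norm]
      linarith [(abs_le.1 this).2]
  have himg : Set.Ioo 0 1 ⊆ (fun x : Plane => x 1) '' coneRidge c := by
    intro t ht
    refine ⟨!₂[0, t], ⟨by simp, by simpa using ht.1, ?_⟩, by simp⟩
    simp only [Matrix.cons_val_one]
    simp
    nlinarith [ht.1, ht.2]
  calc (1 : ℝ≥0∞) = volume (Set.Ioo (0 : ℝ) 1) := by simp
    _ ≤ volume ((fun x : Plane => x 1) '' coneRidge c) := measure_mono himg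
    _ = μH[1] ((fun x : Plane => x 1) '' coneRidge c) := by rw [hausdorffMeasure_real]
    _ ≤ μH[1] (coneRidge c) := by
      simpa using hL.hausdorffMeasure_image_le zero_le_one (coneRidge c)

lemma norm_viscositySolution_le (Ω : Set Plane) (x : Plane) : ‖viscositySolution Ω x‖ ≤ 1 := by
  rw [viscositySolution, norm_perp]
  exact norm_gradient_le (Metric.lipschitz_infDist_pt _) x

theorem le_lineEnergy_viscositySolution {p : ℝ} (hp : 0 ≤ p) (hs : 0 < s) (hc : 0 < c)
    (h : s ^ 2 + c ^ 2 = 1) :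
    powerCost p (2 * s) ≤
      lineEnergy (powerCost p) (coneDomain s c) (viscositySolution (coneDomain s c)) := by
  have hsize : ∀ x ∈ coneRidge c, 2 * s ≤ jumpSize (viscositySolution (coneDomain s c)) x := by
    intro x hx
    have hj := (hasJump_viscositySolution hs hc h hx).2.le_jumpSize (norm_viscositySolution_le _)
    refine le_trans ?_ hj
    refine le_trans ?_ (abs_coord_le_norm _ 1)
    refine le_trans (le_of_eq ?_) (neg_le_abs _)
    simp [perp]
    ring
  calc powerCost p (2 * s) = powerCost p (2 * s) * 1 := (mul_one _).symm
    _ ≤ powerCost p (2 * s) * μH[1] (coneRidge c) := by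
      gcongr
      exact one_le_hausdorffMeasure_coneRidge hc (by nlinarith)
    _ = ∫⁻ _ in coneRidge c, powerCost p (2 * s) ∂(μH[1] : Measure Plane) :=
      (setLIntegral_const _ _).symm
    _ ≤ ∫⁻ x in coneRidge c, powerCost p (jumpSize (viscositySolution (coneDomain s c)) x)
          ∂(μH[1] : Measure Plane) := by
      refine setLIntegral_mono' measurableSet_coneRidge fun x hx => ?_
      refine ENNReal.ofReal_le_ofReal (Real.rpow_le_rpow (by positivity) (hsize x hx) hp)
    _ ≤ _ := by
      refine lintegral_mono_set fun x hx => ?_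
      obtain ⟨h1, h2⟩ := hasJump_viscositySolution hs hc h hx
      exact ⟨h1, _, _, _, h2⟩

/-- The part of the ridge of `coneDomain s c` outside the unit disc. -/
def outerRidge (c : ℝ) : Set Plane := {x | x 0 = 0 ∧ 1 < x 1 ∧ c * x 1 < 1}

/-- The points of the corner region at the same distance from the disc and from the boundary. -/
def medialCurve (s c : ℝ) : Set Plane :=
  {x | c * ‖x‖ < x 1 ∧ ‖x‖ + (s * |x 0| + c * x 1) = 2 ∧ s * |x 0| + c * x 1 < 1}

lemma continuousAt_vortexField_of_contDiffAt {x : Plane} {f : Plane → ℝ} (hf : ContDiffAt ℝ 1 f x)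
    (hu : vortexPotential s c =ᶠ[𝓝 x] f) : ContinuousAt (vortexField s c) x :=
  continuous_perp.continuousAt.comp (continuousAt_gradient (hf.congr_of_eventuallyEq hu))

/-- Off this set a single branch of the maximum is active nearby and is C¹ there, so the field is
continuous and cannot jump. -/
lemma jumpSet_vortexField_subset (hs : 0 < s) (hc : 0 < c) (h : s ^ 2 + c ^ 2 = 1) :
    jumpSet (coneDomain s c) (vortexField s c) ⊆ {0} ∪ (outerRidge c ∪ medialCurve s c) := by
  rintro x ⟨hx, ν, a, b, hj⟩
  have hx : coneGauge s c x < 1 := hx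
  have hncont := hj.not_continuousAt
  have hgc : Continuous (fun y => coneGauge s c y - 1) :=
    (coneGauge_lipschitz hs hc h).continuous.sub continuous_const
  have hnc : Continuous (fun y : Plane => 1 - ‖y‖) := by fun_prop
  by_contra hnot
  simp only [Set.mem_union, Set.mem_singleton_iff, not_or] at hnot
  obtain ⟨hx0, hx1, hx2⟩ := hnot
  apply hncont
  have hcone : 1 < ‖x‖ → c * ‖x‖ < x 1 := by
    intro h1
    by_contra h2
    rw [coneGauge, if_neg h2] at hx
    linarith
  rcases lt_trichotomy (1 - ‖x‖) (coneGauge s c x - 1) with hlt | heq | hgt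
  · have h1 : 1 < ‖x‖ := by linarith
    have h2 := hcone h1
    have h0 : x 0 ≠ 0 := by
      intro h0
      apply hx1
      have hpos : 0 < x 1 := lt_of_le_of_lt (by positivity) h2
      rw [coneGauge, if_pos h2, h0] at hx
      rw [norm_eq_of_coord_zero h0, abs_of_pos hpos] at h1
      exact ⟨h0, h1, by simpa using hx⟩
    refine continuousAt_vortexField_of_contDiffAt
      ((contDiffAt_coneGauge (s := s) (Or.inr ⟨h2, h0⟩)).sub (contDiffAt_const (c := (1 : ℝ)))) ?_
    filter_upwards [hnc.continuousAt.eventually_lt hgc.continuousAt hlt] with y hy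
    exact max_eq_right hy.le
  · have h1 : 1 < ‖x‖ := by linarith
    have h2 := hcone h1
    apply absurd _ hx2
    rw [coneGauge, if_pos h2] at heq hx
    exact ⟨h2, by linarith, hx⟩
  · refine continuousAt_vortexField_of_contDiffAt
      ((contDiffAt_const (c := (1 : ℝ))).sub (contDiffAt_norm ℝ hx0)) ?_
    filter_upwards [hgc.continuousAt.eventually_lt hnc.continuousAt hgt] with y hy
    exact max_eq_left hy.le

lemma dist_le_abs_add_abs (x y : Plane) : dist x y ≤ |x 0 - y 0| + |x 1 - y 1| := by
  rw [dist_eq_norm]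
  refine le_of_sq_le_sq ?_ (by positivity)
  rw [norm_sq_eq, PiLp.sub_apply, PiLp.sub_apply, add_sq, sq_abs, sq_abs]
  have : 0 ≤ 2 * |x 0 - y 0| * |x 1 - y 1| := by positivity
  linarith

lemma hausdorffMeasure_outerRidge_le (hs : 0 < s) (hs1 : s ≤ 3 / 5) (hc : 0 < c)
    (h : s ^ 2 + c ^ 2 = 1) : μH[1] (outerRidge c) ≤ ENNReal.ofReal s := by
  have hc1 : 4 / 5 ≤ c := by nlinarith
  have key := hausdorffMeasure_le_of_dist_le (S := outerRidge c) (K := 1) (i := 1) (a := 1)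
    (b := 1 + s) ?_ ?_
  · simpa using key
  · rintro x ⟨hx, -, -⟩ y ⟨hy, -, -⟩
    have := dist_le_abs_add_abs x y
    simpa [hx, hy] using this
  · rintro x ⟨-, h1, h2⟩
    refine ⟨h1.le, ?_⟩
    by_contra! h3
    nlinarith

/-- The medial curve is a graph over the first coordinate. Its equation gains at least `c` per unit
of height and loses at most `1 + s` per unit of horizontal motion, so its slope is at most `(1 + s)
/ c ≤ (8 / 5) / (4 / 5) = 2`. -/
lemma medialCurve_sub_le (hs : 0 < s) (hs1 : s ≤ 3 / 5) (hc1 : 4 / 5 ≤ c) {x y : Plane}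
    (hx : x ∈ medialCurve s c) (hy : y ∈ medialCurve s c) : x 1 - y 1 ≤ 2 * |x 0 - y 0| := by
  rcases le_total (x 1) (y 1) with hle | hle
  · have := abs_nonneg (x 0 - y 0)
    linarith
  have hy1 : 0 ≤ y 1 := le_trans (by positivity) hy.1.le
  have h1 : ‖y‖ - |x 0 - y 0| ≤ ‖x‖ := by
    have e1 : ‖y‖ ≤ ‖(!₂[y 0, x 1] : Plane)‖ := by
      refine le_of_sq_le_sq ?_ (norm_nonneg _)
      rw [norm_sq_eq, norm_sq_eq]
      simp
      exact pow_le_pow_left₀ hy1 hle 2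
    have e2 : dist (!₂[y 0, x 1] : Plane) x ≤ |x 0 - y 0| := by
      refine (dist_le_abs_add_abs _ _).trans (le_of_eq ?_)
      simp [abs_sub_comm]
    have e3 := norm_sub_norm_le (!₂[y 0, x 1] : Plane) x
    rw [dist_eq_norm] at e2
    linarith
  have h2 : |y 0| - |x 0| ≤ |x 0 - y 0| := by
    rw [abs_sub_comm]
    exact abs_sub_abs_le_abs_sub _ _
  have h3 := hx.2.1
  have h4 := hy.2.1
  have h5 : c * (x 1 - y 1) ≤ (1 + s) * |x 0 - y 0| := by nlinarith
  have := abs_nonneg (x 0 - y 0)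
  nlinarith

lemma hausdorffMeasure_medialCurve_le (hs : 0 < s) (hs1 : s ≤ 3 / 5) (hc : 0 < c)
    (h : s ^ 2 + c ^ 2 = 1) : μH[1] (medialCurve s c) ≤ ENNReal.ofReal (6 * s) := by
  have hc1 : 4 / 5 ≤ c := by nlinarith
  -- `K = 3` is 1 plus the slope bound 2; the projection lies in an interval of length `2 * s`.
  have key := hausdorffMeasure_le_of_dist_le (S := medialCurve s c) (K := 3) (i := 0) (a := -s)
    (b := s) ?_ ?_
  · refine key.trans (le_of_eq ?_)
    rw [show (6 * s) = 3 * (s - -s) by ring, ENNReal.ofReal_mul (by norm_num)]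
    simp
  · intro x hx y hy
    have h1 := medialCurve_sub_le hs hs1 hc1 hx hy
    have h2 := medialCurve_sub_le hs hs1 hc1 hy hx
    rw [abs_sub_comm] at h2
    have h3 : |x 1 - y 1| ≤ 2 * |x 0 - y 0| := abs_le.2 ⟨by linarith, h1⟩
    have := dist_le_abs_add_abs x y
    push_cast
    linarith
  · rintro x ⟨h1, -, h3⟩
    refine abs_le.1 ?_
    -- Adding `c` times `h4` to `s` times `h3` leaves `|x 0| < s`.
    have h4 := mul_abs_lt_of_mem_cone hs hc h h1
    have e : s ^ 2 * |x 0| + c ^ 2 * |x 0| = |x 0| := by rw [← add_mul, h, one_mul]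
    nlinarith

theorem lineEnergy_vortexField_le {p : ℝ} (hp : 0 ≤ p) (hs : 0 < s) (hs1 : s ≤ 3 / 5)
    (hc : 0 < c) (h : s ^ 2 + c ^ 2 = 1) :
    lineEnergy (powerCost p) (coneDomain s c) (vortexField s c) ≤
      powerCost p 2 * ENNReal.ofReal (7 * s) := by
  have := Measure.nullSingletonClass_hausdorff Plane (d := 1) one_pos
  calc _ ≤ ∫⁻ _ in jumpSet (coneDomain s c) (vortexField s c), powerCost p 2
          ∂(μH[1] : Measure Plane) :=
        lintegral_mono fun x => ENNReal.ofReal_le_ofReal (Real.rpow_le_rpow (jumpSize_nonneg _ _)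
          (jumpSize_le_two (norm_vortexField_le hs hc h) x) hp)
    _ = powerCost p 2 * μH[1] (jumpSet (coneDomain s c) (vortexField s c)) :=
      setLIntegral_const _ _
    _ ≤ powerCost p 2 * (μH[1] ({0} : Set Plane) + (μH[1] (outerRidge c) + μH[1] (medialCurve s c))) := by
      gcongr
      refine (measure_mono (jumpSet_vortexField_subset hs hc h)).trans
        ((measure_union_le _ _).trans ?_)
      gcongr
      exact measure_union_le _ _
    _ ≤ powerCost p 2 * (0 + (ENNReal.ofReal s + ENNReal.ofReal (6 * s))) := by
      gcongr
      · exact (measure_singleton _).le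
      · exact hausdorffMeasure_outerRidge_le hs hs1 hc h
      · exact hausdorffMeasure_medialCurve_le hs hs1 hc h
    _ = _ := by
      rw [zero_add, ← ENNReal.ofReal_add hs.le (by positivity)]
      congr 2
      ring

end Energy

/-- `s ^ (p - 1)` tends to infinity as `s → 0⁺`. The 7 is 1 for the outer ridge plus 6 for the
medial curve. -/
lemma exists_small_angle {p : ℝ} (hp : p < 1) :
    ∃ s : ℝ, 0 < s ∧ s ≤ 3 / 5 ∧ 7 * s < s ^ p := by
  obtain ⟨s, hs, hlt, hle⟩ := (((tendsto_rpow_atTop (sub_pos.2 hp)).comp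
    tendsto_inv_nhdsGT_zero).eventually_gt_atTop 7 |>.and
    (Ioo_mem_nhdsGT (by norm_num : (0 : ℝ) < 3 / 5))).exists
  have hs0 : 0 < s := hlt
  refine ⟨s, hs0, hle.le, ?_⟩
  have hs : 7 < s⁻¹ ^ (1 - p) := hs
  calc 7 * s < s⁻¹ ^ (1 - p) * s := by gcongr
    _ = s ^ (p - 1) * s := by rw [Real.inv_rpow hs0.le, ← Real.rpow_neg hs0.le, neg_sub]
    _ = s ^ p := by rw [Real.rpow_sub_one hs0.ne', div_mul_cancel₀ _ hs0.ne']

end LineEnergy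

theorem corollary1 (p : ℝ) (hp0 : 0 ≤ p) (hp1 : p < 1) :
    ∃ Ω : Set LineEnergy.Plane,
      IsOpen Ω ∧ Ω.Nonempty ∧ Bornology.IsBounded Ω ∧ Convex ℝ Ω ∧
      LineEnergy.viscositySolution Ω ∈ LineEnergy.A₀ Ω ∧
      ¬ IsMinOn (LineEnergy.lineEnergy (LineEnergy.powerCost p) Ω) (LineEnergy.A₀ Ω)
          (LineEnergy.viscositySolution Ω) := by
  open LineEnergy in
  obtain ⟨s, hs, hs1, hlt⟩ := exists_small_angle hp1
  have hc : 0 < √(1 - s ^ 2) := Real.sqrt_pos.2 (by nlinarith)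
  have h : s ^ 2 + √(1 - s ^ 2) ^ 2 = 1 := by
    rw [Real.sq_sqrt (by nlinarith)]
    ring
  refine ⟨coneDomain s √(1 - s ^ 2), isOpen_coneDomain hs hc h, ⟨0, ?_⟩,
    isBounded_coneDomain hs hc h, convex_coneDomain hs hc h, viscositySolution_mem_A₀ hs hc h,
    fun hmin => ?_⟩
  · simp [coneDomain, coneGauge]
  · have hle := isMinOn_iff.1 hmin _ (vortexField_mem_A₀ hs hc h)
    refine absurd ((le_lineEnergy_viscositySolution hp0 hs hc h).trans
      (hle.trans (lineEnergy_vortexField_le hp0 hs hs1 hc h))) (not_le.2 ?_)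
    -- The factor `2 ^ p` is common to both estimates, leaving `7 * s < s ^ p`.
    rw [powerCost, powerCost, ← ENNReal.ofReal_mul (by positivity), Real.mul_rpow zero_le_two hs.le]
    exact (ENNReal.ofReal_lt_ofReal_iff (by positivity)).2
      (mul_lt_mul_of_pos_left hlt (by positivity))
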